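/- **Setting.** There are $M$ users, $N$ items, $T\ge 1$ rounds, and an unknown expected reward matrix $R=UV^{\top}\in[-1,1]^{M\times N}$ of rank $r\ge 2$, with $U\in\mathbb R^{M\times r}$, $V\in\mathbb R^{N\times r}$. In each round $t$ every user $u$ is recommended one item $\rho_u(t)$, and $R_{u\rho_u(t)}+E^{(t)}_u$ is observed, where the noise variables are i.i.d., of mean zero and sub-Gaussian with variance proxy $\sigma^2$. Let $\pi_u$ sort the items in descending order of $R_{u\cdot}$. The regret per user is $$\mathrm{Reg}=\frac1M\sum_{t=1}^{T}\sum_{u=1}^{M}\bigl(R_{u\pi_u(1)}-R_{u\rho_u(t)}\bigr).$$ **Assumptions.** (A1) There is a set $A$ of $r$ items (hott items) such that every row $V_j$ of $V$ lies in the convex hull of $\{V_a\}_{a\in A}\cup\{0\}$; moreover the point $0$ is not needed (every $V_j$ lies in the convex hull of $\{V_a\}_{a\in A}$), unless all rewards are non-negative. (A2) For every $a\in A$ the cluster $\mathcal T^{(a)}=\{u:\pi_u(1)=a\}$ has at least $\kappa M/r$ users; $r,\sigma,\kappa>0$ are constants. (A3) There is an offline matrix completion oracle $\mathcal O(\eta,\mathcal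 U,\mathcal V)$ with failure probability $\delta'=\delta/T$: for $0<\eta\le1$ and nonempty sets $\mathcal U$ of users and $\mathcal V$ of items it lasts at least one and at most $C_0\bigl(1+\log\frac{MN}{\delta'}\bigr)^{p_0}\max(1,|\mathcal V|/|\mathcal U|)\,\eta^{-2}$ rounds, in each of which every user of $\mathcal U$ is shown one item of $\mathcal V$, chosen by the oracle with its own private randomness, and it then returns an estimate of $R_{\mathcal U,\mathcal V}$ which with probability at least $1-\delta'$ has all entrywise errors at most $\eta$. **Gaps.** $\Delta=\min_u\bigl(R_{u\pi_u(1)}-R_{u\pi_u(2)}\bigr)$, assumed positive; $\Delta_u=R_{u\pi_u(1)}-\max_{v\in A\setminus\{\pi_u(1)\}}R_{uv}$ and $\Delta_{\mathrm{hott}}=\min_{a\in A}\max_{u\in\mathcal T^{(a)}}\Delta_u$. **Algorithm (PhasedClusterElim).** Each user $u$ has a candidate set $T_u$, initially all items; two users are connected if their candidate sets intersect. While an oracle call is in progress, every user outside $\mathcal U$ is shown a uniformly random item of its candidate set. *Pruning at level $c$* replaces $T_u$ by the items of $T_u$ that have a current estimate which is within $c$ of the largest current estimate for $u$; the current estimates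 are those of the phase just completed. Stage 1: with accuracy $k=1,\frac12,\frac14,\dots$ estimate the whole matrix and prune at level $3k$, until there are $r$ pairwise disconnected users $u_1,\dots,u_r$. Then replace $k$ by $k/10$ and estimate the whole matrix once more. Stage 2: repeat until round $T$ is over: prune at level $3k$; give $u$ the label $i$ if $u$ is connected to $u_i$; for a user with more than one label replace $T_u$ by the set of items whose estimate for $u$ is within $12k$ of the largest one and which lie in $T_{C_i}$ for some label $i$ of $u$, where $T_{C_i}$ is the set of items common to the (new) candidate sets of all users with label $i$ (precisely, $x\in T_{C_i}$ iff $x\in T_u$ for each user $u$ with the single label $i$, and the estimate of $x$ is within $12k$ of the largest one for each user with label $i$ and further labels); halve $k$; for each $i=1,\dots,r$ call $\mathcal O(k,\mathcal U_i,T_{C_i})$ with $\mathcal U_i=\{u:T_u\cap T_{C_i}\ne\emptyset\}$. **Theorem.** There are constants $C>0$ and $p$ depending only on $r,\kappa,\sigma,C_0,p_0$ such that for all $M,N,T$, all $\delta\in(0,1)$ and all instances as above, PhasedClusterElim satisfies, with probability at least $1-\delta$, $$\mathrm{Reg}\le C\Bigl(1+\log\tfrac{MNT}{\delta}\Bigr)^{p}\Bigl(\max\bigl(1,\tfrac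 NM\bigr)\bigl(\Delta_{\mathrm{hott}}^{-2}+\Delta^{-1}\bigr)+1\Bigr),$$ and if $\delta\le 1/T$, then $\mathbb E[\mathrm{Reg}]$ is finite and satisfies the same bound. That is, the per-user regret is $\widetilde O\bigl(\max(1,N/M)(\Delta_{\mathrm{hott}}^{-2}+\Delta^{-1})+1\bigr)$. -/

import Mathlib

open MeasureTheory ProbabilityTheory

/-! ### Rewards, orderings and gaps -/

section Gaps

variable {M N : ℕ} [NeZero N]

/-- `π u` lists the items in descending order of their expected reward for user `u`. -/
def IsRewardOrdering (R : Matrix (Fin M) (Fin N) ℝ) (π : Fin M → Equiv.Perm (Fin N)) : Prop :=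
  ∀ u, Antitone fun i => R u (π u i)

/-- The hott items property: every item vector (row of `V`) lies in the convex hull of the `r`
vectors of the items in `A` together with the zero vector. -/
def HottItems {r : ℕ} (V : Matrix (Fin N) (Fin r) ℝ) (A : Finset (Fin N)) : Prop :=
  A.card = r ∧ ∀ j, V j ∈ convexHull ℝ ((fun a => V a) '' (A : Set (Fin N)) ∪ {0})

/-- The cluster of users whose best item is `a`. -/
def userCluster (π : Fin M → Equiv.Perm (Fin N)) (a : Fin N) : Finset (Fin M) :=
  Finset.univ.filter fun u => π u 0 = a

/-- The gap of user `u` between the best item and the best other hott item. -/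
noncomputable def hottGapOfUser (R : Matrix (Fin M) (Fin N) ℝ) (π : Fin M → Equiv.Perm (Fin N))
    (A : Finset (Fin N)) (u : Fin M) : ℝ :=
  R u (π u 0) - ⨆ v : {v : Fin N // v ∈ A.erase (π u 0)}, R u v

/-- `Δ_hott`: in every cluster take the largest hott item gap, then minimize over the clusters. -/
noncomputable def hottGap (R : Matrix (Fin M) (Fin N) ℝ) (π : Fin M → Equiv.Perm (Fin N))
    (A : Finset (Fin N)) : ℝ :=
  ⨅ a : {a : Fin N // a ∈ A}, ⨆ u : {u : Fin M // u ∈ userCluster π a}, hottGapOfUser R π A u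

/-- `Δ`: the smallest gap, over all users, between the best and the second best item. -/
noncomputable def rewardGap (R : Matrix (Fin M) (Fin N) ℝ)
    (π : Fin M → Equiv.Perm (Fin N)) : ℝ :=
  ⨅ u, (R u (π u 0) - R u (π u 1))

end Gaps

/-! ### The offline matrix completion oracle -/

/-- A (randomized) offline matrix completion procedure. Called with an accuracy `η`, a set of
users `rows` and a set of items `cols`, it lasts `rounds η rows cols` rounds. Using its private
random seed it fixes the item `sample … s u` of `cols` that user `u ∈ rows` is shown in its round
`s`; from the noisy rewards so observed it then computes an estimate of the matrix. -/
structure MCOracle (M N : ℕ) (Seed : Type*) [MeasurableSpace Seed] where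
  seedLaw : Measure Seed
  seedLaw_prob : IsProbabilityMeasure seedLaw
  rounds : ℝ → Finset (Fin M) → Finset (Fin N) → ℕ
  rounds_pos : ∀ η rows cols, 1 ≤ rounds η rows cols
  sample : ℝ → Finset (Fin M) → Finset (Fin N) → Seed → ℕ → Fin M → Fin N
  sample_mem : ∀ η rows cols seed s u, cols.Nonempty → u ∈ rows →
    s < rounds η rows cols → sample η rows cols seed s u ∈ cols
  measurable_sample : ∀ η rows cols s u, Measurable fun seed => sample η rows cols seed s u
  estimate : (η : ℝ) → (rows : Finset (Fin M)) → (cols : Finset (Fin N)) → Seed →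
    (Fin (rounds η rows cols) → {u : Fin M // u ∈ rows} → ℝ) → Fin M → Fin N → ℝ
  measurable_estimate : ∀ η rows cols u x, Measurable fun
    p : Seed × (Fin (rounds η rows cols) → {u : Fin M // u ∈ rows} → ℝ) =>
      estimate η rows cols p.1 p.2 u x

attribute [instance] MCOracle.seedLaw_prob

section Oracle

variable {M N : ℕ} {Seed : Type*} [MeasurableSpace Seed]

/-- The estimate computed by the oracle with a given seed, when the observation of user `u` in
round `s` of the call is the expected reward of the sampled item plus the noise `z s u`. -/
def MCOracle.estimateOf (O : MCOracle M N Seed) (R : Matrix (Fin M) (Fin N) ℝ) (η : ℝ)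
    (rows : Finset (Fin M)) (cols : Finset (Fin N)) (seed : Seed) (z : ℕ → Fin M → ℝ) :
    Fin M → Fin N → ℝ :=
  O.estimate η rows cols seed fun s u => R u (O.sample η rows cols seed s u) + z s u

/-- The guarantee of the oracle on the reward matrix `R` with i.i.d. noise of law `ν`: for every
accuracy `η ∈ (0, 1]` and all nonempty `rows`, `cols`, it uses at most
`B · max(1, |cols| / |rows|) / η²` observations per row, and with probability at least `1 - δ`
its estimate of the sub-matrix of `R` on `rows × cols` is entrywise `η`-accurate. -/
structure MCOracle.Guarantee (O : MCOracle M N Seed) (R : Matrix (Fin M) (Fin N) ℝ)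
    (ν : Measure ℝ) [IsProbabilityMeasure ν] (B δ : ℝ) : Prop where
  rounds_le : ∀ (η : ℝ) (rows : Finset (Fin M)) (cols : Finset (Fin N)), 0 < η → η ≤ 1 →
    rows.Nonempty → cols.Nonempty →
    (O.rounds η rows cols : ℝ) ≤ B * max 1 ((cols.card : ℝ) / rows.card) / η ^ 2
  accurate : ∀ (η : ℝ) (rows : Finset (Fin M)) (cols : Finset (Fin N)), 0 < η → η ≤ 1 →
    rows.Nonempty → cols.Nonempty →
    (O.seedLaw.prod (Measure.infinitePi fun _ : ℕ => Measure.pi fun _ : Fin M => ν))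
      {p | ∃ u ∈ rows, ∃ x ∈ cols, η < |O.estimateOf R η rows cols p.1 p.2 u x - R u x|}
      ≤ ENNReal.ofReal δ

end Oracle

/-! ### The algorithm `PhasedClusterElim` -/

section Algorithm

variable {M N r : ℕ}

/-- A partially known matrix: `none` marks the entries that have not been estimated. -/
abbrev PartialEstimate (M N : ℕ) := Fin M → Fin N → Option ℝ

/-- Item `x` has an estimate for user `u`, which is within `c` of the estimate of the item that
is best for `u` according to the estimates. -/
def EstimatedWithin (E : PartialEstimate M N) (c : ℝ) (u : Fin M) (x : Fin N) : Prop :=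
  ∃ a, E u x = some a ∧ ∀ y b, E u y = some b → b - a ≤ c

open Classical in
/-- Elimination: keep the candidates of each user whose estimated gap is at most `c`. -/
noncomputable def pruneItems (E : PartialEstimate M N) (c : ℝ)
    (cand : Fin M → Finset (Fin N)) (u : Fin M) : Finset (Fin N) :=
  (cand u).filter fun x => EstimatedWithin E c u x

/-- Two users are connected iff their candidate sets intersect. -/
def Connected (cand : Fin M → Finset (Fin N)) (u v : Fin M) : Prop :=
  (cand u ∩ cand v).Nonempty

/-- `v` lists `r` distinct users, no two of which are connected. -/
def IsIndependentSet (cand : Fin M → Finset (Fin N)) (v : Fin r → Fin M) : Prop :=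
  Function.Injective v ∧ ∀ i j, i ≠ j → ¬ Connected cand (v i) (v j)

open Classical in
/-- The labels of user `u`: the seed users to which `u` is connected. -/
noncomputable def labels (cand : Fin M → Finset (Fin N)) (v : Fin r → Fin M) (u : Fin M) :
    Finset (Fin r) :=
  Finset.univ.filter fun i => Connected cand (v i) u

open Classical in
/-- The common good items of group `i`: the items `x` such that every user `u` with label `i` has
`x` as a candidate if `u` has no other label, and has estimated gap at most `c` for `x` if `u` has
several labels. -/
noncomputable def groupItems (E : PartialEstimate M N) (c : ℝ) (cand : Fin M → Finset (Fin N))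
    (v : Fin r → Fin M) (i : Fin r) : Finset (Fin N) :=
  Finset.univ.filter fun x => ∀ u, i ∈ labels cand v u →
    if 1 < (labels cand v u).card then EstimatedWithin E c u x else x ∈ cand u

open Classical in
/-- Expansion: the candidate set of a user with several labels is replaced by the items with
estimated gap at most `c` that belong to the common good items of one of its labels. -/
noncomputable def expandItems (E : PartialEstimate M N) (c : ℝ) (cand : Fin M → Finset (Fin N))
    (v : Fin r → Fin M) (u : Fin M) : Finset (Fin N) :=
  if 1 < (labels cand v u).card then
    Finset.univ.filter fun x =>
      EstimatedWithin E c u x ∧ ∃ i ∈ labels cand v u, x ∈ groupItems E c cand v i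
  else cand u

open Classical in
/-- The common good items of group `i` are the items shared by the candidate sets, after the
expansion, of all users connected to the `i`-th seed user. -/
theorem mem_groupItems_iff (E : PartialEstimate M N) (c : ℝ) (cand : Fin M → Finset (Fin N))
    (v : Fin r → Fin M) (i : Fin r) (x : Fin N) :
    x ∈ groupItems E c cand v i ↔ ∀ u, i ∈ labels cand v u → x ∈ expandItems E c cand v u := by
  constructor
  · intro hx u hu
    have h := (Finset.mem_filter.1 hx).2 u hu
    unfold expandItems
    split_ifs with hc
    · rw [if_pos hc] at h
      exact Finset.mem_filter.2 ⟨Finset.mem_univ _, h, i, hu, hx⟩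
    · rwa [if_neg hc] at h
  · intro h
    refine Finset.mem_filter.2 ⟨Finset.mem_univ _, fun u hu => ?_⟩
    have h' := h u hu
    unfold expandItems at h'
    split_ifs with hc
    · rw [if_pos hc] at h'
      exact (Finset.mem_filter.1 h').2.1
    · rwa [if_neg hc] at h'

/-- The users of group `i`: those whose candidates (after the expansion) meet its good items. -/
noncomputable def groupUsers (E : PartialEstimate M N) (c : ℝ) (cand : Fin M → Finset (Fin N))
    (v : Fin r → Fin M) (i : Fin r) : Finset (Fin M) :=
  Finset.univ.filter fun u => (expandItems E c cand v u ∩ groupItems E c cand v i).Nonempty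

/-- State of the algorithm when it is about to call the oracle. -/
structure ElimState (M N r : ℕ) where
  /-- the round in which the call starts -/
  start : ℕ
  /-- the accuracy `k` of the current phase -/
  acc : ℝ
  /-- the candidate set of every user -/
  cand : Fin M → Finset (Fin N)
  /-- the opinionated users, once they have been found -/
  seeds : Option (Fin r → Fin M)
  /-- the estimates obtained so far in the current phase -/
  est : PartialEstimate M N
  /-- the sub-matrix on which the oracle is about to be called -/
  block : Finset (Fin M) × Finset (Fin N)
  /-- the sub-matrices still to be estimated in the current phase after that -/
  pending : List (Finset (Fin M) × Finset (Fin N))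

/-- The initial state. For `r ≥ 2` the complete graph has no independent set of size `r`, so the
first stage is entered, with accuracy `1` on the whole matrix. -/
def initState : ElimState M N r where
  start := 0
  acc := 1
  cand := fun _ => Finset.univ
  seeds := none
  est := fun _ _ => none
  block := (Finset.univ, Finset.univ)
  pending := []

open Classical in
/-- The start of a new phase at round `start`, when all sub-matrices of the phase described by `s`
have been estimated, with estimates `E`. The candidates are pruned at level `3k`. In the first
stage, if there are `r` pairwise disconnected users, they are recorded as seed users and the whole
matrix is estimated once more, with accuracy `k / 10`; otherwise with accuracy `k / 2`. In
the second stage the candidates of the users with several labels are expanded at level `12k`, and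
the sub-matrices of the `r` groups are estimated, with accuracy `k / 2`. -/
noncomputable def nextPhase (s : ElimState M N r) (start : ℕ) (E : PartialEstimate M N) :
    ElimState M N r :=
  let cand := pruneItems E (3 * s.acc) s.cand
  match s.seeds with
  | none =>
    if h : ∃ v : Fin r → Fin M, IsIndependentSet cand v then
      { start := start, acc := s.acc / 10, cand := cand, seeds := some h.choose,
        est := fun _ _ => none, block := (Finset.univ, Finset.univ), pending := [] }
    else
      { start := start, acc := s.acc / 2, cand := cand, seeds := none,
        est := fun _ _ => none, block := (Finset.univ, Finset.univ), pending := [] }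
  | some v =>
    let blocks := (List.finRange r).map fun i =>
      (groupUsers E (12 * s.acc) cand v i, groupItems E (12 * s.acc) cand v i)
    { start := start, acc := s.acc / 2, cand := expandItems E (12 * s.acc) cand v,
      seeds := some v, est := fun _ _ => none,
      block := blocks.headD (∅, ∅), pending := blocks.tail }

/-- Enter the values `Q` into the partial estimate `E` on the sub-matrix `rows × cols`. -/
def recordBlock (E : PartialEstimate M N) (Q : Fin M → Fin N → ℝ)
    (b : Finset (Fin M) × Finset (Fin N)) : PartialEstimate M N :=
  fun u x => if u ∈ b.1 ∧ x ∈ b.2 then some (Q u x) else E u x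

variable {Seed : Type*} [MeasurableSpace Seed]

/-- One oracle call, with private seed `seed` and noise `noise t u` for user `u` in round `t`. -/
noncomputable def elimStep (O : MCOracle M N Seed) (R : Matrix (Fin M) (Fin N) ℝ) (seed : Seed)
    (noise : ℕ → Fin M → ℝ) (s : ElimState M N r) : ElimState M N r :=
  let finish := s.start + O.rounds s.acc s.block.1 s.block.2
  let E := recordBlock s.est
    (O.estimateOf R s.acc s.block.1 s.block.2 seed fun i u => noise (s.start + i) u) s.block
  match s.pending with
  | [] => nextPhase s finish E
  | b :: bs => { s with start := finish, est := E, block := b, pending := bs }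

/-- All the randomness of a run: the seeds of the oracle calls, the noise of every round and user,
and for every round and user the item that is picked from each set of items, if the user has to
be shown a random item of that set. -/
abbrev RunSpace (M N : ℕ) (Seed : Type*) :=
  (ℕ → Seed) × (ℕ → Fin M → ℝ) × (ℕ → Fin M → Finset (Fin N) → Fin N)

/-- The state before the `n`-th oracle call. -/
noncomputable def elimRun (r : ℕ) (O : MCOracle M N Seed) (R : Matrix (Fin M) (Fin N) ℝ)
    (ω : RunSpace M N Seed) : ℕ → ElimState M N r
  | 0 => initState
  | n + 1 => elimStep O R (ω.1 n) ω.2.1 (elimRun r O R ω n)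

/-- The index of the oracle call that is in progress in round `t`. -/
noncomputable def callAt (r : ℕ) (O : MCOracle M N Seed) (R : Matrix (Fin M) (Fin N) ℝ)
    (ω : RunSpace M N Seed) (t : ℕ) : ℕ :=
  Nat.findGreatest (fun n => (elimRun r O R ω n).start ≤ t) t

/-- The item `ρ_u(t)` recommended to user `u` in round `t`: the item sampled by the oracle if `u`
belongs to the sub-matrix being estimated, a random candidate of `u` otherwise. -/
noncomputable def recommend (r : ℕ) (O : MCOracle M N Seed) (R : Matrix (Fin M) (Fin N) ℝ)
    (ω : RunSpace M N Seed) (t : ℕ) (u : Fin M) : Fin N :=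
  let n := callAt r O R ω t
  let s := elimRun r O R ω n
  if u ∈ s.block.1 then
    O.sample s.acc s.block.1 s.block.2 (ω.1 n) (t - s.start) u
  else ω.2.2 t u (s.cand u)

/-- The regret per user over the first `T` rounds. -/
noncomputable def regret [NeZero N] (r : ℕ) (O : MCOracle M N Seed)
    (R : Matrix (Fin M) (Fin N) ℝ) (π : Fin M → Equiv.Perm (Fin N)) (T : ℕ)
    (ω : RunSpace M N Seed) : ℝ :=
  (1 / (M : ℝ)) * ((∑ _t ∈ Finset.range T, ∑ u, R u (π u 0)) -
    ∑ t ∈ Finset.range T, ∑ u, R u (recommend r O R ω t u))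

/-- The uniform law on the set `S` of items (on all items if `S` is empty). -/
noncomputable def pickLaw (S : Finset (Fin N)) : Measure (Fin N) :=
  uniformOn (if S.Nonempty then (S : Set (Fin N)) else Set.univ)

instance [NeZero N] (S : Finset (Fin N)) : IsProbabilityMeasure (pickLaw S) := by
  unfold pickLaw
  split_ifs with h
  · exact isProbabilityMeasure_uniformOn (Set.toFinite _) h
  · exact isProbabilityMeasure_uniformOn (Set.toFinite _) Set.univ_nonempty

/-- The law of the randomness of a run: independent seeds with the law of the oracle, i.i.d. noise
with law `ν`, and independent uniform picks. -/
noncomputable def runLaw [NeZero N] (O : MCOracle M N Seed) (ν : Measure ℝ)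
    [IsProbabilityMeasure ν] : Measure (RunSpace M N Seed) :=
  (Measure.infinitePi fun _ : ℕ => O.seedLaw).prod
    ((Measure.infinitePi fun _ : ℕ => Measure.pi fun _ : Fin M => ν).prod
      (Measure.infinitePi fun _ : ℕ => Measure.pi fun _ : Fin M =>
        Measure.pi fun S : Finset (Fin N) => pickLaw S))

end Algorithm

/-!
Call the difference between the rewards of the best item of a user and of an item `x` the gap of
`x`. The hott items property makes the gaps of every item a convex combination, with the same
weights for all users, of the gaps of the hott items and of a virtual item standing for zero
(`gap_decomposition`); in particular all best items are hott items.

Suppose that all oracle calls are accurate. In the first stage, pruning leaves candidates with gap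
at most five times the accuracy, and once the accuracy is below a multiple of the hott items gap,
users that separate the hott items have disjoint candidate sets (`exists_isIndependentSet`). So all
accuracies of the first stage are at least a multiple of the hott items gap, and a geometric sum
bounds the number of rounds by its inverse square.

In the second stage every seed user has a clear best item, and distinct seed users have
distinct ones. A candidate `x` of a seed user then consists for at least one half of the best item
of that user, so that a user sharing the candidate `x` finds this best item almost as good as `x`
(`HottInstance.gap_best_le`). It follows that the best item of the seed user is a common good
item of its group, that the group contains the whole cluster of this item, and that the
users of a group are all connected to its seed user. Hence each item shown in a phase of accuracy
`c` has a gap of order `c` (`SeedInvariant.next`), and a call, which lasts about `1 / c ^ 2` rounds,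
costs regret `1 / c`, or nothing when `c` is small against `Δ`. This is again a geometric
sum; `RunInvariant` carries the accumulated regret along the run.

A call uses a fresh seed and the noise of rounds that come after everything which determined its
parameters, so it fails with probability at most `δ / T` (`runLaw_not_accurateCall_le`). At most `T`
calls matter, and the union bound gives the high probability statement; on the exceptional event
the regret is at most `2 * T`, which contributes at most `2` to the expectation if `δ ≤ 1 / T`.
-/

/-! ### Gaps of items and the geometry of hott items -/

/-- The gap of item `x` for user `u`, relative to the item `best u`. -/
def itemGap {M N : ℕ} (R : Matrix (Fin M) (Fin N) ℝ) (best : Fin M → Fin N) (u : Fin M)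
    (x : Fin N) : ℝ :=
  R u (best u) - R u x

/-- What the analysis of the algorithm uses about an instance: `best u` is the best item of `u`,
all other items have gap at least `Δ`, and `H` plays the role of the hott items gap. The
field `decomp` is the hott items property in terms of gaps: the gaps of any item `x` are convex
combinations, with the same weights for all users, of the gaps of the hott items and of a virtual
item (standing for the zero vector) that is at least as bad as every hott item. -/
structure HottInstance {M N : ℕ} (R : Matrix (Fin M) (Fin N) ℝ) (best : Fin M → Fin N)
    (A : Finset (Fin N)) (Δ H : ℝ) : Prop where
  nonneg : ∀ u x, 0 ≤ itemGap R best u x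
  le_two : ∀ u x, itemGap R best u x ≤ 2
  gap_of_ne : ∀ u x, x ≠ best u → Δ ≤ itemGap R best u x
  gap_pos : 0 < Δ
  hott_pos : 0 < H
  best_mem : ∀ u, best u ∈ A
  two_le_card : 2 ≤ A.card
  decomp : ∀ x, ∃ (l : Fin N → ℝ) (l₀ : ℝ), (∀ b ∈ A, 0 ≤ l b) ∧ 0 ≤ l₀ ∧ ∑ b ∈ A, l b + l₀ = 1 ∧
    ∀ u, ∃ z, (∀ b ∈ A, itemGap R best u b ≤ z) ∧
      itemGap R best u x = ∑ b ∈ A, l b * itemGap R best u b + l₀ * z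
  separated : ∀ a ∈ A, ∃ u, best u = a ∧ ∀ b ∈ A, b ≠ a → H ≤ itemGap R best u b

section Hott

variable {M N : ℕ} {R : Matrix (Fin M) (Fin N) ℝ} {best : Fin M → Fin N}
  {A : Finset (Fin N)} {Δ H : ℝ}

@[simp]
theorem itemGap_best (u : Fin M) : itemGap R best u (best u) = 0 := sub_self _

/-- If all hott items other than `a` have gap at least `g` for some user, the weight that the item
`x` gives to `a` is close to one as soon as the gap of `x` for that user is small against `g`. -/
theorem HottInstance.exists_weight (h : HottInstance R best A Δ H) (x : Fin N) :
    ∃ l : Fin N → ℝ, (∀ b ∈ A, 0 ≤ l b) ∧ ∑ b ∈ A, l b ≤ 1 ∧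
      (∀ u, ∀ a ∈ A, l a * itemGap R best u a ≤ itemGap R best u x) ∧
      ∀ u g, ∀ a ∈ A, (∀ b ∈ A, b ≠ a → g ≤ itemGap R best u b) →
        (1 - l a) * g ≤ itemGap R best u x := by
  classical
  obtain ⟨l, l₀, hl, hl₀, hsum, hx⟩ := h.decomp x
  refine ⟨l, hl, by linarith, fun u a ha => ?_, fun u g a ha hg => ?_⟩
  · obtain ⟨z, hz, he⟩ := hx u
    rw [he]
    have h1 : l a * itemGap R best u a ≤ ∑ b ∈ A, l b * itemGap R best u b :=
      Finset.single_le_sum (f := fun b => l b * itemGap R best u b)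
        (fun b hb => mul_nonneg (hl b hb) (h.nonneg u b)) ha
    have h2 : 0 ≤ z := (h.nonneg u a).trans (hz a ha)
    have := mul_nonneg hl₀ h2
    linarith
  · obtain ⟨z, hz, he⟩ := hx u
    obtain ⟨b, hb, hba⟩ : ∃ b ∈ A, b ≠ a :=
      Finset.exists_mem_ne (lt_of_lt_of_le one_lt_two h.two_le_card) a
    have hgz : g ≤ z := (hg b hb hba).trans (hz b hb)
    rw [he, ← Finset.add_sum_erase A _ ha]
    rw [← Finset.add_sum_erase A _ ha] at hsum
    have h1 : ∑ c ∈ A.erase a, l c * g ≤ ∑ c ∈ A.erase a, l c * itemGap R best u c :=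
      Finset.sum_le_sum fun c hc => mul_le_mul_of_nonneg_left
        (hg c (Finset.mem_of_mem_erase hc) (Finset.ne_of_mem_erase hc))
        (hl c (Finset.mem_of_mem_erase hc))
    rw [← Finset.sum_mul] at h1
    have h2 := mul_le_mul_of_nonneg_left hgz hl₀
    have h3 := mul_nonneg (hl a ha) (h.nonneg u a)
    have : (1 - l a) * g = (∑ c ∈ A.erase a, l c) * g + l₀ * g := by rw [← hsum]; ring
    linarith

/-- An item that is nearly optimal for a user `v` all of whose other hott items are bad consists
mostly of the best item of `v`; for any user `w` that item is hence not much worse than `x`. -/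
theorem HottInstance.gap_best_le (h : HottInstance R best A Δ H) {v w : Fin M} {x : Fin N} {c : ℝ}
    (hc : 0 < c) (hfar : ∀ b ∈ A, b ≠ best v → 10 * c ≤ itemGap R best v b)
    (hx : itemGap R best v x ≤ 5 * c) :
    itemGap R best w (best v) ≤ 2 * itemGap R best w x := by
  obtain ⟨l, -, -, hl, hl'⟩ := h.exists_weight x
  have h1 := hl' v _ _ (h.best_mem v) hfar
  have h2 := hl w _ (h.best_mem v)
  have h3 : 1 / 2 ≤ l (best v) := by
    by_contra hlt
    push Not at hlt
    nlinarith
  nlinarith [h.nonneg w (best v)]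

/-- Two users that separate distinct hott items well have no nearly optimal item in common. -/
theorem HottInstance.not_common (h : HottInstance R best A Δ H) {v w : Fin M} {x : Fin N} {c : ℝ}
    (hc : 10 * c < H) (hne : best v ≠ best w)
    (hv : ∀ b ∈ A, b ≠ best v → H ≤ itemGap R best v b)
    (hw : ∀ b ∈ A, b ≠ best w → H ≤ itemGap R best w b)
    (hxv : itemGap R best v x ≤ 5 * c) (hxw : itemGap R best w x ≤ 5 * c) : False := by
  classical
  obtain ⟨l, hl0, hsum, -, hl'⟩ := h.exists_weight x
  have h1 := hl' v _ _ (h.best_mem v) hv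
  have h2 := hl' w _ _ (h.best_mem w) hw
  have h3 : l (best v) + l (best w) ≤ 1 := by
    rw [← Finset.sum_pair hne (f := l)]
    refine le_trans (Finset.sum_le_sum_of_subset_of_nonneg ?_ fun b hb _ => hl0 b hb) hsum
    intro b hb
    rcases Finset.mem_insert.1 hb with rfl | hb
    · exact h.best_mem _
    · rw [Finset.mem_singleton.1 hb]; exact h.best_mem _
  nlinarith [h.hott_pos]

end Hott

/-! ### Estimates on a list of sub-matrices -/

section Estimates

variable {M N : ℕ} {R : Matrix (Fin M) (Fin N) ℝ} {best : Fin M → Fin N}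
  {A : Finset (Fin N)} {Δ H : ℝ}

/-- The entry `(u, x)` lies in one of the sub-matrices of the list `L`. -/
def Covered (L : List (Finset (Fin M) × Finset (Fin N))) (u : Fin M) (x : Fin N) : Prop :=
  ∃ b ∈ L, u ∈ b.1 ∧ x ∈ b.2

/-- `E` estimates exactly the entries covered by `L`, each with error at most `c`. -/
structure AccurateOn (R : Matrix (Fin M) (Fin N) ℝ) (E : PartialEstimate M N) (c : ℝ)
    (L : List (Finset (Fin M) × Finset (Fin N))) : Prop where
  err : ∀ u x a, E u x = some a → |a - R u x| ≤ c
  iff : ∀ u x, (∃ a, E u x = some a) ↔ Covered L u x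

theorem accurateOn_nil (c : ℝ) : AccurateOn R (fun _ _ => none) c [] :=
  ⟨fun _ _ _ h => by simp at h, fun _ _ => by simp [Covered]⟩

theorem AccurateOn.recordBlock {E : PartialEstimate M N} {c : ℝ}
    {L : List (Finset (Fin M) × Finset (Fin N))} (h : AccurateOn R E c L)
    {b : Finset (Fin M) × Finset (Fin N)} {Q : Fin M → Fin N → ℝ}
    (hQ : ∀ u ∈ b.1, ∀ x ∈ b.2, |Q u x - R u x| ≤ c) :
    AccurateOn R (_root_.recordBlock E Q b) c (L ++ [b]) := by
  constructor
  · intro u x a ha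
    unfold _root_.recordBlock at ha
    split_ifs at ha with hb
    · rw [← Option.some.inj ha]
      exact hQ u hb.1 x hb.2
    · exact h.err u x a ha
  · intro u x
    unfold _root_.recordBlock
    split_ifs with hb
    · exact ⟨fun _ => ⟨b, by simp, hb⟩, fun _ => ⟨_, rfl⟩⟩
    · rw [h.iff]
      simp only [Covered, List.mem_append, List.mem_singleton]
      constructor
      · rintro ⟨b', h1, h2⟩
        exact ⟨b', Or.inl h1, h2⟩
      · rintro ⟨b', h1 | rfl, h2⟩
        · exact ⟨b', h1, h2⟩
        · exact absurd h2 hb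

variable {E : PartialEstimate M N} {c : ℝ} {L : List (Finset (Fin M) × Finset (Fin N))}

theorem EstimatedWithin.covered (hE : AccurateOn R E c L) {l : ℝ} {u : Fin M} {x : Fin N}
    (h : EstimatedWithin E l u x) : Covered L u x := by
  obtain ⟨a, ha, -⟩ := h
  exact (hE.iff u x).1 ⟨a, ha⟩

theorem EstimatedWithin.gap_le (hE : AccurateOn R E c L) {l : ℝ} {u : Fin M} {x : Fin N}
    (h : EstimatedWithin E l u x) (hb : Covered L u (best u)) :
    itemGap R best u x ≤ l + 2 * c := by
  obtain ⟨a, ha, hmax⟩ := h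
  obtain ⟨b, hb⟩ := (hE.iff u _).2 hb
  have h1 := abs_le.1 (hE.err _ _ _ ha)
  have h2 := abs_le.1 (hE.err _ _ _ hb)
  have h3 := hmax _ _ hb
  unfold itemGap
  linarith [h1.1, h1.2, h2.1, h2.2]

theorem estimatedWithin_of_gap_le (h : HottInstance R best A Δ H) (hE : AccurateOn R E c L) {l : ℝ}
    {u : Fin M} {x : Fin N} (hx : Covered L u x) (hg : itemGap R best u x + 2 * c ≤ l) :
    EstimatedWithin E l u x := by
  obtain ⟨a, ha⟩ := (hE.iff u x).2 hx
  refine ⟨a, ha, fun y b hb => ?_⟩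
  have h1 := abs_le.1 (hE.err _ _ _ ha)
  have h2 := abs_le.1 (hE.err _ _ _ hb)
  have h3 := h.nonneg u y
  unfold itemGap at h3 hg
  linarith [h1.1, h1.2, h2.1, h2.2]

theorem mem_pruneItems {l : ℝ} {cand : Fin M → Finset (Fin N)} {u : Fin M} {x : Fin N} :
    x ∈ pruneItems E l cand u ↔ x ∈ cand u ∧ EstimatedWithin E l u x := by
  simp [pruneItems]

end Estimates

/-! ### One phase of the first stage -/

section Exploration

variable {M N r : ℕ} {R : Matrix (Fin M) (Fin N) ℝ} {best : Fin M → Fin N}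
  {A : Finset (Fin N)} {Δ H : ℝ} {E : PartialEstimate M N} {c : ℝ}
  {cand : Fin M → Finset (Fin N)}

theorem covered_univ (u : Fin M) (x : Fin N) :
    Covered [((Finset.univ : Finset (Fin M)), (Finset.univ : Finset (Fin N)))] u x :=
  ⟨_, List.mem_singleton.2 rfl, Finset.mem_univ _, Finset.mem_univ _⟩

theorem mem_pruneItems_of_gap_le (h : HottInstance R best A Δ H)
    (hE : AccurateOn R E c [(Finset.univ, Finset.univ)])
    (hcand : ∀ u x, itemGap R best u x ≤ c → x ∈ cand u) {u : Fin M} {x : Fin N}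
    (hx : itemGap R best u x ≤ c) : x ∈ pruneItems E (3 * c) cand u :=
  mem_pruneItems.2 ⟨hcand u x hx, estimatedWithin_of_gap_le h hE (covered_univ u x) (by linarith)⟩

/-- Once the accuracy is small against the hott items gap, users that separate the hott items
best are pairwise disconnected. -/
theorem exists_isIndependentSet (h : HottInstance R best A Δ H) (hA : A.card = r)
    (hE : AccurateOn R E c [(Finset.univ, Finset.univ)]) (hc : 10 * c < H) :
    ∃ v : Fin r → Fin M, IsIndependentSet (pruneItems E (3 * c) cand) v := by
  choose w hw1 hw2 using fun a : A => h.separated a a.2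
  let e : Fin r ≃ A := (finCongr hA.symm).trans A.equivFin.symm
  have hb : ∀ i, best (w (e i)) = e i := fun i => hw1 (e i)
  have hne : ∀ i j, i ≠ j → best (w (e i)) ≠ best (w (e j)) := by
    intro i j hij heq
    rw [hb, hb] at heq
    exact hij (e.injective (Subtype.ext heq))
  refine ⟨fun i => w (e i), fun i j hij => ?_, fun i j hij => ?_⟩
  · by_contra hne'
    exact hne i j hne' (congrArg best hij)
  · rintro ⟨x, hx⟩
    obtain ⟨h1, h2⟩ := Finset.mem_inter.1 hx
    have g1 := (mem_pruneItems.1 h1).2.gap_le hE (best := best) (covered_univ _ _)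
    have g2 := (mem_pruneItems.1 h2).2.gap_le hE (best := best) (covered_univ _ _)
    exact h.not_common hc (hne i j hij)
      (fun b hbA hbn => hw2 (e i) b hbA (by rwa [hb] at hbn))
      (fun b hbA hbn => hw2 (e j) b hbA (by rwa [hb] at hbn)) (by linarith) (by linarith)

end Exploration

/-! ### One phase of the second stage -/

section Groups

variable {M N r : ℕ} {R : Matrix (Fin M) (Fin N) ℝ} {best : Fin M → Fin N}
  {A : Finset (Fin N)} {Δ H : ℝ} {E : PartialEstimate M N} {c : ℝ}
  {cand : Fin M → Finset (Fin N)} {v : Fin r → Fin M}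
  {L : List (Finset (Fin M) × Finset (Fin N))}

/-- The invariant of the second stage at the start of a phase with accuracy `c`, candidate sets
`cand` and sub-matrices `L`. The seed users `v i` are pairwise disconnected, their best items
are all the hott items, and `far` says that the others are clearly separated from the best one.
The field `cover` is what lets the next phase compare the best item of `v i` for every user
connected to `v i`. -/
structure SeedInvariant (R : Matrix (Fin M) (Fin N) ℝ) (best : Fin M → Fin N) (A : Finset (Fin N))
    (c : ℝ) (cand : Fin M → Finset (Fin N)) (v : Fin r → Fin M)
    (L : List (Finset (Fin M) × Finset (Fin N))) : Prop where
  disjoint : ∀ i j x, x ∈ cand (v i) → x ∈ cand (v j) → i = j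
  best_mem : ∀ u, best u ∈ cand u
  surj : ∀ u, ∃ i, best (v i) = best u
  far : ∀ i, ∀ b ∈ A, b ≠ best (v i) → 10 * c ≤ itemGap R best (v i) b
  cover_seed : ∀ i, Covered L (v i) (best (v i))
  cover : ∀ i w x, x ∈ cand w → x ∈ cand (v i) → Covered L (v i) x → Covered L w (best (v i))

/-- The phase in which the whole matrix is estimated once more satisfies the invariant. -/
theorem seedInvariant_of_isIndependentSet (h : HottInstance R best A Δ H) (hA : A.card = r)
    (hc : 0 < c) (hcand : ∀ u x, itemGap R best u x ≤ c → x ∈ cand u)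
    (hv : IsIndependentSet cand v) :
    SeedInvariant R best A (c / 10) cand v [(Finset.univ, Finset.univ)] := by
  have hb : ∀ u, best u ∈ cand u := fun u => hcand u _ (by rw [itemGap_best]; exact hc.le)
  have hdis : ∀ i j x, x ∈ cand (v i) → x ∈ cand (v j) → i = j := by
    intro i j x hi hj
    by_contra hne
    exact hv.2 i j hne ⟨x, Finset.mem_inter.2 ⟨hi, hj⟩⟩
  have hinj : Function.Injective fun i => best (v i) := by
    intro i j hij
    refine hdis i j (best (v i)) (hb _) ?_
    have hij' : best (v i) = best (v j) := hij
    rw [hij']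
    exact hb _
  have himg : Finset.univ.image (fun i => best (v i)) = A := by
    refine Finset.eq_of_subset_of_card_le ?_ ?_
    · intro x hx
      obtain ⟨i, -, rfl⟩ := Finset.mem_image.1 hx
      exact h.best_mem _
    · rw [Finset.card_image_of_injective _ hinj, hA]
      simp
  have hsurj : ∀ a ∈ A, ∃ i, best (v i) = a := by
    intro a ha
    rw [← himg] at ha
    obtain ⟨i, -, hi⟩ := Finset.mem_image.1 ha
    exact ⟨i, hi⟩
  refine ⟨hdis, hb, fun u => hsurj _ (h.best_mem u), fun i b hbA hne => ?_,
    fun i => covered_univ _ _, fun i w x _ _ _ => covered_univ _ _⟩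
  obtain ⟨j, rfl⟩ := hsurj b hbA
  by_contra hlt
  have hle : itemGap R best (v i) (best (v j)) ≤ c := by linarith
  exact hne (by rw [hdis i j _ (hcand _ _ hle) (hb _)])

/-- The sub-matrices of the groups, which are estimated in a phase of the second stage. -/
noncomputable def groupBlocks (E : PartialEstimate M N) (l : ℝ) (cand : Fin M → Finset (Fin N))
    (v : Fin r → Fin M) : List (Finset (Fin M) × Finset (Fin N)) :=
  (List.finRange r).map fun i => (groupUsers E l cand v i, groupItems E l cand v i)

theorem covered_groupBlocks {l : ℝ} {u : Fin M} {x : Fin N} :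
    Covered (groupBlocks E l cand v) u x ↔
      ∃ i, u ∈ groupUsers E l cand v i ∧ x ∈ groupItems E l cand v i := by
  simp [Covered, groupBlocks]

theorem mem_labels {i : Fin r} {u : Fin M} :
    i ∈ labels cand v u ↔ ∃ x, x ∈ cand (v i) ∧ x ∈ cand u := by
  simp [labels, Connected, Finset.Nonempty, Finset.mem_inter]

theorem mem_groupUsers {l : ℝ} {i : Fin r} {u : Fin M} :
    u ∈ groupUsers E l cand v i ↔
      ∃ x, x ∈ expandItems E l cand v u ∧ x ∈ groupItems E l cand v i := by
  simp [groupUsers, Finset.Nonempty, Finset.mem_inter]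

/-- A sub-matrix to be estimated with accuracy `c` in the second stage: it has an item, it contains
the whole cluster of some hott item, and all of its entries have gap at most `28 c`. -/
structure GoodBlock (R : Matrix (Fin M) (Fin N) ℝ) (best : Fin M → Fin N) (A : Finset (Fin N))
    (c : ℝ) (b : Finset (Fin M) × Finset (Fin N)) : Prop where
  items_nonempty : b.2.Nonempty
  cluster : ∃ a ∈ A, ∀ u, best u = a → u ∈ b.1
  gap_le : ∀ u ∈ b.1, ∀ x ∈ b.2, itemGap R best u x ≤ 28 * c

/-- A phase of the second stage maintains the invariant: the candidates of the next phase, and the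
entries of the sub-matrices estimated in it, have gap at most `14 c`. -/
theorem SeedInvariant.next (h : HottInstance R best A Δ H) (hc : 0 < c)
    (hI : SeedInvariant R best A c cand v L) (hE : AccurateOn R E c L) :
    SeedInvariant R best A (c / 2)
        (expandItems E (12 * c) (pruneItems E (3 * c) cand) v) v
        (groupBlocks E (12 * c) (pruneItems E (3 * c) cand) v) ∧
      (∀ u, ∀ x ∈ expandItems E (12 * c) (pruneItems E (3 * c) cand) v u,
        itemGap R best u x ≤ 28 * (c / 2)) ∧
      ∀ b ∈ groupBlocks E (12 * c) (pruneItems E (3 * c) cand) v, GoodBlock R best A (c / 2) b := by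
  classical
  set cand' := pruneItems E (3 * c) cand with hcand'
  have hsub : ∀ u x, x ∈ cand' u → x ∈ cand u := fun u x hx => (mem_pruneItems.1 hx).1
  have hcov : ∀ u x, x ∈ cand' u → Covered L u x := fun u x hx =>
    (mem_pruneItems.1 hx).2.covered hE
  have hcb : ∀ u, Covered L u (best u) := by
    intro u
    obtain ⟨i, hi⟩ := hI.surj u
    rw [← hi]
    refine hI.cover i u (best u) (hI.best_mem u) ?_ ?_
    · rw [← hi]; exact hI.best_mem _
    · rw [← hi]; exact hI.cover_seed i
  have hgap : ∀ u x, x ∈ cand' u → itemGap R best u x ≤ 5 * c := fun u x hx => by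
    have := (mem_pruneItems.1 hx).2.gap_le hE (hcb u)
    linarith
  have hbest : ∀ u, best u ∈ cand' u := fun u =>
    mem_pruneItems.2 ⟨hI.best_mem u, estimatedWithin_of_gap_le h hE (hcb u)
      (by rw [itemGap_best]; linarith)⟩
  have hdis : ∀ i j x, x ∈ cand' (v i) → x ∈ cand' (v j) → i = j := fun i j x hi hj =>
    hI.disjoint i j x (hsub _ _ hi) (hsub _ _ hj)
  have hlab_best : ∀ i u, best (v i) = best u → i ∈ labels cand' v u := fun i u hi =>
    mem_labels.2 ⟨best u, by rw [← hi]; exact hbest _, hbest u⟩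
  have hlab_seed : ∀ i j, j ∈ labels cand' v (v i) → j = i := by
    intro i j hj
    obtain ⟨x, h1, h2⟩ := mem_labels.1 hj
    exact hdis j i x h1 h2
  have hcard_seed : ∀ i, ¬ 1 < (labels cand' v (v i)).card := by
    intro i hi
    obtain ⟨j, hj, k, hk, hjk⟩ := Finset.one_lt_card.1 hi
    exact hjk ((hlab_seed i j hj).trans (hlab_seed i k hk).symm)
  -- every user connected to a seed user regards the best item of the seed user as nearly optimal
  have hwithin : ∀ i w, i ∈ labels cand' v w → EstimatedWithin E (12 * c) w (best (v i)) := by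
    intro i w hi
    obtain ⟨x, h1, h2⟩ := mem_labels.1 hi
    have hg := h.gap_best_le (w := w) hc (hI.far i) (hgap _ _ h1)
    refine estimatedWithin_of_gap_le h hE
      (hI.cover i w x (hsub _ _ h2) (hsub _ _ h1) (hcov _ _ h1)) ?_
    linarith [hgap _ _ h2]
  have hitem : ∀ i, best (v i) ∈ groupItems E (12 * c) cand' v i := by
    intro i
    unfold groupItems
    refine Finset.mem_filter.2 ⟨Finset.mem_univ _, fun w hw => ?_⟩
    split_ifs with hcard
    · exact hwithin i w hw
    · obtain ⟨j, hj⟩ := hI.surj w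
      have hij : i = j :=
        Finset.card_le_one.1 (not_lt.1 hcard) _ hw _ (hlab_best j w hj)
      rw [hij, hj]
      exact hbest w
  have hexp_seed : ∀ i, expandItems E (12 * c) cand' v (v i) = cand' (v i) := by
    intro i
    unfold expandItems
    rw [if_neg (hcard_seed i)]
  have hitem_sub : ∀ i x, x ∈ groupItems E (12 * c) cand' v i → x ∈ cand' (v i) := by
    intro i x hx
    rw [← hexp_seed]
    exact (mem_groupItems_iff _ _ _ _ _ _).1 hx _ (hlab_best i _ rfl)
  have hexp_gap : ∀ u, ∀ x ∈ expandItems E (12 * c) cand' v u,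
      itemGap R best u x ≤ 28 * (c / 2) := by
    intro u x hx
    unfold expandItems at hx
    split_ifs at hx with hcard
    · have := (Finset.mem_filter.1 hx).2.1.gap_le hE (hcb u)
      linarith
    · linarith [hgap u x hx]
  have hbest_exp : ∀ u, best u ∈ expandItems E (12 * c) cand' v u := by
    intro u
    obtain ⟨i, hi⟩ := hI.surj u
    rw [← hi]
    exact (mem_groupItems_iff _ _ _ _ _ _).1 (hitem i) u (hlab_best i u hi)
  -- the good items of distinct groups are disjoint, so that a user of a group has its label
  have huser : ∀ i u, u ∈ groupUsers E (12 * c) cand' v i → i ∈ labels cand' v u := by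
    intro i u hu
    obtain ⟨x, h1, h2⟩ := mem_groupUsers.1 hu
    unfold expandItems at h1
    split_ifs at h1 with hcard
    · obtain ⟨-, -, j, hj, hxj⟩ := Finset.mem_filter.1 h1
      rw [hdis i j x (hitem_sub _ _ h2) (hitem_sub _ _ hxj)]
      exact hj
    · exact mem_labels.2 ⟨x, hitem_sub _ _ h2, h1⟩
  refine ⟨⟨?_, hbest_exp, hI.surj, fun i b hb hne => ?_, fun i => ?_, fun i w x hw hx hL => ?_⟩,
    hexp_gap, fun b hb => ?_⟩
  · intro i j x hi hj
    rw [hexp_seed] at hi hj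
    exact hdis i j x hi hj
  · linarith [hI.far i b hb hne]
  · exact covered_groupBlocks.2 ⟨i, mem_groupUsers.2 ⟨_, hbest_exp _, hitem i⟩, hitem i⟩
  · obtain ⟨j, h1, h2⟩ := covered_groupBlocks.1 hL
    have hji : j = i := hlab_seed i j (huser j _ h1)
    subst hji
    exact covered_groupBlocks.2 ⟨j, mem_groupUsers.2 ⟨x, hw, h2⟩, hitem j⟩
  · obtain ⟨i, -, rfl⟩ := List.mem_map.1 hb
    refine ⟨⟨_, hitem i⟩, ⟨best (v i), h.best_mem _, fun u hu => ?_⟩, fun u hu x hx => ?_⟩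
    · exact mem_groupUsers.2 ⟨best u, hbest_exp u, hu ▸ hitem i⟩
    · exact hexp_gap u x ((mem_groupItems_iff _ _ _ _ _ _).1 hx u (huser i u hu))

end Groups

/-! ### The invariant of the run and the regret accumulated so far -/

section Potential

/-- `1 / c`, capped at a multiple of `1 / Δ`: bounds the sum of `phaseCost` over the accuracies
`2 c, 4 c, …` of the earlier phases. -/
noncomputable def phasePotential (Δ c : ℝ) : ℝ := min (1 / c) (56 / Δ)

/-- Up to a constant, the regret of a call with accuracy `c` in the second stage: about `1 / c ^ 2`
rounds with regret `c`, but no regret once `c` is so small that only best items are shown. -/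
noncomputable def phaseCost (Δ c : ℝ) : ℝ := if Δ ≤ 28 * c then 1 / c else 0

variable {Δ c : ℝ}

theorem phasePotential_nonneg (hΔ : 0 < Δ) (hc : 0 < c) : 0 ≤ phasePotential Δ c :=
  le_min (by positivity) (by positivity)

theorem phaseCost_nonneg (hc : 0 < c) : 0 ≤ phaseCost Δ c := by
  unfold phaseCost
  split_ifs
  · positivity
  · exact le_rfl

theorem phaseCost_le (hΔ : 0 < Δ) (hc : 0 < c) : phaseCost Δ c ≤ 28 / Δ := by
  unfold phaseCost
  split_ifs with h
  · rw [div_le_div_iff₀ hc hΔ]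
    linarith
  · positivity

theorem phasePotential_add_phaseCost (hΔ : 0 < Δ) (hc : 0 < c) :
    phasePotential Δ c + phaseCost Δ c ≤ phasePotential Δ (c / 2) := by
  have h2 : 1 / (c / 2) = 1 / c + 1 / c := by field_simp; norm_num
  have hpos : 0 < 1 / c := by positivity
  unfold phasePotential
  rw [h2]
  refine le_min ?_ ?_
  · have h3 : phaseCost Δ c ≤ 1 / c := by
      unfold phaseCost
      split_ifs
      · exact le_rfl
      · exact hpos.le
    linarith [min_le_left (1 / c) (56 / Δ)]
  · unfold phaseCost
    split_ifs with h
    · have h4 : 1 / c ≤ 28 / Δ := by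
        rw [div_le_div_iff₀ hc hΔ]
        linarith
      have h5 : 56 / Δ = 28 / Δ + 28 / Δ := by ring
      linarith [min_le_left (1 / c) (56 / Δ)]
    · linarith [min_le_right (1 / c) (56 / Δ)]

end Potential

section Invariant

variable {M N r : ℕ}

/-- The items that user `u` can be shown during the call that is about to start. -/
def shownItems (s : ElimState M N r) (u : Fin M) : Finset (Fin N) :=
  if u ∈ s.block.1 then s.block.2 else s.cand u

/-- The invariant of the algorithm before an oracle call, as long as all earlier calls were
accurate; `S` is the regret per user accumulated before the call, and `W / c ^ 2` bounds
the number of rounds of a call with accuracy `c`. The cases are the first stage, the call that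
estimates the whole matrix once more, and the calls for the groups. The accuracy is divided by `10`
at the end of the first stage, whence the factor `3 / 100`, and it is then at least `H / 200`, whence
the constant `120000 = 3 * 200 ^ 2`. -/
inductive RunInvariant (R : Matrix (Fin M) (Fin N) ℝ) (best : Fin M → Fin N) (A : Finset (Fin N))
    (Δ H W : ℝ) (s : ElimState M N r) (S : ℝ) : Prop
  | explore (acc_pos : 0 < s.acc) (acc_le : s.acc ≤ 1) (seeds : s.seeds = none)
      (block : s.block = (Finset.univ, Finset.univ)) (pending : s.pending = [])
      (est : s.est = fun _ _ => none) (hott_le : H ≤ 20 * s.acc)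
      (cand : ∀ u x, itemGap R best u x ≤ s.acc → x ∈ s.cand u)
      (cost : S ≤ W / s.acc ^ 2)
  | reestimate (v : Fin r → Fin M) (acc_pos : 0 < s.acc) (acc_le : s.acc ≤ 1)
      (seeds : s.seeds = some v)
      (block : s.block = (Finset.univ, Finset.univ)) (pending : s.pending = [])
      (est : s.est = fun _ _ => none) (hott_le : H ≤ 200 * s.acc)
      (inv : SeedInvariant R best A s.acc s.cand v [(Finset.univ, Finset.univ)])
      (cost : S ≤ 3 / 100 * (W / s.acc ^ 2))
  | group (v : Fin r → Fin M) (done : List (Finset (Fin M) × Finset (Fin N)))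
      (acc_pos : 0 < s.acc) (acc_le : s.acc ≤ 1)
      (seeds : s.seeds = some v)
      (length : (done ++ s.block :: s.pending).length = r)
      (good : ∀ b ∈ done ++ s.block :: s.pending, GoodBlock R best A s.acc b)
      (cand_gap : ∀ u, ∀ x ∈ s.cand u, itemGap R best u x ≤ 28 * s.acc)
      (est : AccurateOn R s.est s.acc done)
      (inv : SeedInvariant R best A s.acc s.cand v (done ++ s.block :: s.pending))
      (cost : S ≤ 120000 * W / H ^ 2 +
        28 * W * (r * phasePotential Δ s.acc + done.length * phaseCost Δ s.acc))

variable {R : Matrix (Fin M) (Fin N) ℝ} {best : Fin M → Fin N}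
  {A : Finset (Fin N)} {Δ H W : ℝ} {s : ElimState M N r} {S : ℝ}

theorem RunInvariant.acc_mem (hs : RunInvariant R best A Δ H W s S) : 0 < s.acc ∧ s.acc ≤ 1 := by
  cases hs with
  | explore h1 h2 => exact ⟨h1, h2⟩
  | reestimate _ h1 h2 => exact ⟨h1, h2⟩
  | group _ _ h1 h2 => exact ⟨h1, h2⟩

theorem RunInvariant.cand_nonempty (hs : RunInvariant R best A Δ H W s S) (u : Fin M) :
    (s.cand u).Nonempty := by
  cases hs with
  | explore h1 _ _ _ _ _ _ h => exact ⟨best u, h u _ (by rw [itemGap_best]; exact h1.le)⟩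
  | reestimate _ _ _ _ _ _ _ _ h => exact ⟨best u, h.best_mem u⟩
  | group _ _ _ _ _ _ _ _ _ h => exact ⟨best u, h.best_mem u⟩

theorem RunInvariant.block_nonempty [NeZero N] (hs : RunInvariant R best A Δ H W s S) :
    s.block.2.Nonempty := by
  cases hs with
  | explore _ _ _ h => rw [h]; exact Finset.univ_nonempty
  | reestimate _ _ _ _ h => rw [h]; exact Finset.univ_nonempty
  | group _ _ _ _ _ _ h => exact (h s.block (by simp)).items_nonempty

theorem RunInvariant.cluster_subset_block (h : HottInstance R best A Δ H)
    (hs : RunInvariant R best A Δ H W s S) :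
    ∃ a ∈ A, ∀ u, best u = a → u ∈ s.block.1 := by
  have ⟨a, ha⟩ : A.Nonempty := Finset.card_pos.1 (by linarith [h.two_le_card])
  cases hs with
  | explore _ _ _ h => rw [h]; exact ⟨a, ha, fun u _ => Finset.mem_univ u⟩
  | reestimate _ _ _ _ h => rw [h]; exact ⟨a, ha, fun u _ => Finset.mem_univ u⟩
  | group _ _ _ _ _ _ h => exact (h s.block (by simp)).cluster

theorem RunInvariant.initState (h : HottInstance R best A Δ H) (hW : 0 ≤ W) :
    RunInvariant R best A Δ H W (initState : ElimState M N r) 0 := by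
  refine .explore one_pos le_rfl rfl rfl rfl rfl ?_ (fun u x _ => Finset.mem_univ x) ?_
  · obtain ⟨a, ha⟩ : A.Nonempty := Finset.card_pos.1 (by linarith [h.two_le_card])
    obtain ⟨b, hb, hne⟩ : ∃ b ∈ A, b ≠ a :=
      Finset.exists_mem_ne (lt_of_lt_of_le one_lt_two h.two_le_card) a
    obtain ⟨u, -, hu⟩ := h.separated a ha
    simp only [_root_.initState]
    linarith [hu b hb hne, h.le_two u b]
  · simpa [_root_.initState] using hW

/-- The accumulated regret is bounded, uniformly over all states. -/
theorem RunInvariant.cost_le (h : HottInstance R best A Δ H) (hW : 0 ≤ W)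
    (hs : RunInvariant R best A Δ H W s S) :
    S ≤ 120000 * W / H ^ 2 + 2352 * r * W / Δ := by
  have hΔ := h.gap_pos
  have hH := h.hott_pos
  have hpos : 0 ≤ 2352 * r * W / Δ := by positivity
  have key : ∀ k : ℝ, 0 < k → H ≤ k * s.acc → 0 < s.acc → W / s.acc ^ 2 ≤ k ^ 2 * W / H ^ 2 := by
    intro k hk hle hacc
    rw [div_le_div_iff₀ (by positivity) (by positivity)]
    have : H ^ 2 ≤ (k * s.acc) ^ 2 := pow_le_pow_left₀ hH.le hle 2
    calc W * H ^ 2 ≤ W * (k * s.acc) ^ 2 := mul_le_mul_of_nonneg_left this hW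
      _ = k ^ 2 * W * s.acc ^ 2 := by ring
  have hX : 0 ≤ W / H ^ 2 := by positivity
  cases hs with
  | explore h1 _ _ _ _ _ h2 _ hS =>
    have := key 20 (by norm_num) h2 h1
    have e1 : (20 : ℝ) ^ 2 * W / H ^ 2 = 400 * (W / H ^ 2) := by ring
    have e2 : 120000 * W / H ^ 2 = 120000 * (W / H ^ 2) := by ring
    linarith
  | reestimate _ h1 _ _ _ _ _ h2 _ hS =>
    have := key 200 (by norm_num) h2 h1
    have e1 : (200 : ℝ) ^ 2 * W / H ^ 2 = 40000 * (W / H ^ 2) := by ring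
    have e2 : 120000 * W / H ^ 2 = 120000 * (W / H ^ 2) := by ring
    linarith
  | group _ done h1 _ _ hlen _ _ _ _ hS =>
    have hd : (done.length : ℝ) ≤ r := by
      have : done.length ≤ r := by rw [← hlen, List.length_append]; omega
      exact_mod_cast this
    have h3 : r * phasePotential Δ s.acc ≤ r * (56 / Δ) :=
      mul_le_mul_of_nonneg_left (min_le_right _ _) (Nat.cast_nonneg _)
    have h4 : done.length * phaseCost Δ s.acc ≤ r * (28 / Δ) :=
      mul_le_mul hd (phaseCost_le hΔ h1) (phaseCost_nonneg h1) (Nat.cast_nonneg _)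
    have h5 : 28 * W * (r * phasePotential Δ s.acc + done.length * phaseCost Δ s.acc) ≤
        28 * W * (r * (56 / Δ) + r * (28 / Δ)) :=
      mul_le_mul_of_nonneg_left (by linarith) (by positivity)
    have e : 28 * W * (r * (56 / Δ) + r * (28 / Δ)) = 2352 * r * W / Δ := by ring
    linarith

variable {Seed : Type*} [MeasurableSpace Seed] {O : MCOracle M N Seed} {seed : Seed}
  {noise : ℕ → Fin M → ℝ}

/-- The partial estimate after an oracle call. -/
noncomputable def estimateAfter (O : MCOracle M N Seed) (R : Matrix (Fin M) (Fin N) ℝ) (seed : Seed)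
    (noise : ℕ → Fin M → ℝ) (s : ElimState M N r) : PartialEstimate M N :=
  recordBlock s.est
    (O.estimateOf R s.acc s.block.1 s.block.2 seed fun i u => noise (s.start + i) u) s.block

theorem elimStep_of_pending_nil (h : s.pending = []) :
    elimStep O R seed noise s = nextPhase s (s.start + O.rounds s.acc s.block.1 s.block.2)
      (estimateAfter O R seed noise s) := by
  simp only [elimStep, h]
  rfl

theorem elimStep_of_pending_cons {b : Finset (Fin M) × Finset (Fin N)}
    {bs : List (Finset (Fin M) × Finset (Fin N))} (h : s.pending = b :: bs) :
    elimStep O R seed noise s =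
      { s with
        start := s.start + O.rounds s.acc s.block.1 s.block.2
        est := estimateAfter O R seed noise s
        block := b
        pending := bs } := by
  simp only [elimStep, h]
  rfl

theorem nextPhase_of_seeds_none {m : ℕ} {E : PartialEstimate M N} (h : s.seeds = none) :
    (∃ v, IsIndependentSet (pruneItems E (3 * s.acc) s.cand) v ∧
      nextPhase s m E =
        { start := m, acc := s.acc / 10, cand := pruneItems E (3 * s.acc) s.cand, seeds := some v,
          est := fun _ _ => none, block := (Finset.univ, Finset.univ), pending := [] }) ∨
    (¬ ∃ v : Fin r → Fin M, IsIndependentSet (pruneItems E (3 * s.acc) s.cand) v) ∧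
      nextPhase s m E =
        { start := m, acc := s.acc / 2, cand := pruneItems E (3 * s.acc) s.cand, seeds := none,
          est := fun _ _ => none, block := (Finset.univ, Finset.univ), pending := [] } := by
  by_cases hv : ∃ v : Fin r → Fin M, IsIndependentSet (pruneItems E (3 * s.acc) s.cand) v
  · exact Or.inl ⟨hv.choose, hv.choose_spec, by simp only [nextPhase, h, dif_pos hv]⟩
  · exact Or.inr ⟨hv, by simp only [nextPhase, h, dif_neg hv]⟩

theorem nextPhase_of_seeds_some {m : ℕ} {E : PartialEstimate M N} {v : Fin r → Fin M}
    (h : s.seeds = some v) :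
    nextPhase s m E =
      { start := m
        acc := s.acc / 2
        cand := expandItems E (12 * s.acc) (pruneItems E (3 * s.acc) s.cand) v
        seeds := some v
        est := fun _ _ => none
        block :=
          (groupBlocks E (12 * s.acc) (pruneItems E (3 * s.acc) s.cand) v).headD (∅, ∅)
        pending := (groupBlocks E (12 * s.acc) (pruneItems E (3 * s.acc) s.cand) v).tail } := by
  simp only [nextPhase, h]
  rfl

/-- The start of a phase of the second stage, from an invariant of the phase before. -/
theorem RunInvariant.nextPhase (h : HottInstance R best A Δ H) (hr : 2 ≤ r)
    {v : Fin r → Fin M} {L : List (Finset (Fin M) × Finset (Fin N))} {E : PartialEstimate M N}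
    {m : ℕ} (hacc : 0 < s.acc) (hacc1 : s.acc ≤ 1) (hv : s.seeds = some v)
    (hI : SeedInvariant R best A s.acc s.cand v L) (hE : AccurateOn R E s.acc L)
    (hS : S ≤ 120000 * W / H ^ 2 + 28 * W * (r * phasePotential Δ (s.acc / 2))) :
    RunInvariant R best A Δ H W (nextPhase s m E) S := by
  obtain ⟨h1, h2, h3⟩ := hI.next h hacc hE
  rw [nextPhase_of_seeds_some hv]
  set B := groupBlocks E (12 * s.acc) (pruneItems E (3 * s.acc) s.cand) v with hB
  have hlen : B.length = r := by simp [hB, groupBlocks]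
  obtain ⟨b, bs, hbs⟩ : ∃ b bs, B = b :: bs := by
    cases hB' : B with
    | nil => rw [hB'] at hlen; simp at hlen; omega
    | cons b bs => exact ⟨b, bs, rfl⟩
  rw [hbs] at h1 h3 hlen ⊢
  exact .group v [] (half_pos hacc) (by simp only; linarith) rfl hlen h3 h2
    (accurateOn_nil _) h1 (by simpa using hS)

/-- An accurate oracle call maintains the invariant. The hypothesis on `S'` says that
the regret per round is at most the largest gap of the items that can be shown. -/
theorem RunInvariant.elimStep (h : HottInstance R best A Δ H) (hA : A.card = r) (hW : 0 ≤ W)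
    (hs : RunInvariant R best A Δ H W s S)
    (hacc : ∀ u ∈ s.block.1, ∀ x ∈ s.block.2,
      |O.estimateOf R s.acc s.block.1 s.block.2 seed (fun i u => noise (s.start + i) u) u x
        - R u x| ≤ s.acc)
    (hrounds : (O.rounds s.acc s.block.1 s.block.2 : ℝ) ≤ W / s.acc ^ 2) {S' : ℝ}
    (hS' : ∀ w, (∀ u, ∀ x ∈ shownItems s u, itemGap R best u x ≤ w) →
      S' ≤ S + O.rounds s.acc s.block.1 s.block.2 * w) :
    RunInvariant R best A Δ H W (elimStep O R seed noise s) S' := by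
  have hr : 2 ≤ r := hA ▸ h.two_le_card
  have hΔ := h.gap_pos
  have hH := h.hott_pos
  have htwo := hS' 2 fun u x _ => h.le_two u x
  cases hs with
  | explore hc hc1 hseeds hb hp hest hHle hcand hS =>
    have hE : AccurateOn R (estimateAfter O R seed noise s) s.acc [(Finset.univ, Finset.univ)] := by
      have := (accurateOn_nil (R := R) s.acc).recordBlock hacc
      rw [← hest, hb] at this
      simpa [estimateAfter, hb] using this
    have hcand' : ∀ u x, itemGap R best u x ≤ s.acc →
        x ∈ pruneItems (estimateAfter O R seed noise s) (3 * s.acc) s.cand u :=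
      fun u x hx => mem_pruneItems_of_gap_le h hE hcand hx
    rw [elimStep_of_pending_nil hp]
    rcases nextPhase_of_seeds_none (s := s) (m := s.start + O.rounds s.acc s.block.1 s.block.2)
      (E := estimateAfter O R seed noise s) hseeds with ⟨v, hv, he⟩ | ⟨hv, he⟩
    · rw [he]
      refine .reestimate v (by simp only; positivity) (by simp only; linarith) rfl rfl rfl rfl
        (by simp only; linarith)
        (seedInvariant_of_isIndependentSet h hA hc hcand' hv) ?_
      have e : W / (s.acc / 10) ^ 2 = 100 * (W / s.acc ^ 2) := by field_simp; norm_num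
      simp only
      rw [e]
      linarith
    · rw [he]
      have hHle' : H ≤ 10 * s.acc := by
        by_contra hlt
        exact hv (exists_isIndependentSet h hA hE (not_le.1 hlt))
      refine .explore (by simp only; positivity) (by simp only; linarith) rfl rfl rfl rfl
        (by simp only; linarith) (fun u x hx => hcand' u x ?_) ?_
      · simp only at hx
        linarith
      · have e : W / (s.acc / 2) ^ 2 = 4 * (W / s.acc ^ 2) := by field_simp; norm_num
        have : 0 ≤ W / s.acc ^ 2 := by positivity
        simp only
        rw [e]
        linarith
  | reestimate v hc hc1 hseeds hb hp hest hHle hI hS =>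
    have hE : AccurateOn R (estimateAfter O R seed noise s) s.acc [(Finset.univ, Finset.univ)] := by
      have := (accurateOn_nil (R := R) s.acc).recordBlock hacc
      rw [← hest, hb] at this
      simpa [estimateAfter, hb] using this
    rw [elimStep_of_pending_nil hp]
    refine RunInvariant.nextPhase h hr hc hc1 hseeds hI hE ?_
    have h1 : W / s.acc ^ 2 ≤ 40000 * W / H ^ 2 := by
      rw [div_le_div_iff₀ (by positivity) (by positivity)]
      have : H ^ 2 ≤ (200 * s.acc) ^ 2 := pow_le_pow_left₀ hH.le hHle 2
      calc W * H ^ 2 ≤ W * (200 * s.acc) ^ 2 := mul_le_mul_of_nonneg_left this hW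
        _ = 40000 * W * s.acc ^ 2 := by ring
    have h2 : 0 ≤ 28 * W * (r * phasePotential Δ (s.acc / 2)) := by
      have := phasePotential_nonneg hΔ (half_pos hc)
      positivity
    have h3 : 0 ≤ W / s.acc ^ 2 := by positivity
    have e : 120000 * W / H ^ 2 = 3 * (40000 * W / H ^ 2) := by ring
    linarith
  | group v done hc hc1 hseeds hlen hgood hcg hest hI hS =>
    have hE : AccurateOn R (estimateAfter O R seed noise s) s.acc (done ++ [s.block]) :=
      hest.recordBlock hacc
    have hshown : ∀ u, ∀ x ∈ shownItems s u, itemGap R best u x ≤ 28 * s.acc := by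
      intro u x hx
      unfold shownItems at hx
      split_ifs at hx with hu
      · exact (hgood s.block (by simp)).gap_le u hu x hx
      · exact hcg u x hx
    have hcost : S' ≤ S + 28 * W * phaseCost Δ s.acc := by
      unfold phaseCost
      split_ifs with hle
      · refine (hS' _ hshown).trans ?_
        have h1 := mul_le_mul_of_nonneg_right hrounds (by positivity : 0 ≤ 28 * s.acc)
        have e : W / s.acc ^ 2 * (28 * s.acc) = 28 * W * (1 / s.acc) := by
          field_simp
        linarith
      · -- gaps below `Δ` vanish: only best items are shown
        have := hS' 0 fun u x hx => by
          by_cases hxb : x = best u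
          · rw [hxb, itemGap_best]
          · linarith [h.gap_of_ne u x hxb, hshown u x hx]
        linarith
    cases hp : s.pending with
    | nil =>
      rw [elimStep_of_pending_nil hp]
      rw [hp] at hlen hI
      refine RunInvariant.nextPhase h hr hc hc1 hseeds hI hE ?_
      have hd : (done.length : ℝ) = r - 1 := by
        simp only [List.length_append, List.length_cons, List.length_nil] at hlen
        rw [← hlen]
        push_cast
        ring
      rw [hd] at hS
      have h1 := mul_le_mul_of_nonneg_left (phasePotential_add_phaseCost hΔ hc)
        (by positivity : 0 ≤ 28 * W * r)
      have e : 28 * W * (r * phasePotential Δ s.acc + (r - 1) * phaseCost Δ s.acc)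
          + 28 * W * phaseCost Δ s.acc
          = 28 * W * r * (phasePotential Δ s.acc + phaseCost Δ s.acc) := by ring
      linarith
    | cons b bs =>
      rw [elimStep_of_pending_cons hp]
      have happ : done ++ s.block :: s.pending = (done ++ [s.block]) ++ b :: bs := by
        rw [hp]; simp
      rw [happ] at hlen hgood hI
      refine .group v (done ++ [s.block]) hc hc1 hseeds hlen hgood hcg hE hI ?_
      have e : ((done ++ [s.block]).length : ℝ) = done.length + 1 := by simp
      simp only
      rw [e]
      linarith

end Invariant

/-! ### Runs in which every call is accurate -/

section Run

variable {M N r : ℕ} {Seed : Type*} [MeasurableSpace Seed] {O : MCOracle M N Seed}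
  {R : Matrix (Fin M) (Fin N) ℝ}

theorem nextPhase_start (s : ElimState M N r) (m : ℕ) (E : PartialEstimate M N) :
    (nextPhase s m E).start = m := by
  cases h : s.seeds with
  | none => rcases nextPhase_of_seeds_none (m := m) (E := E) h with ⟨v, -, he⟩ | ⟨-, he⟩ <;> rw [he]
  | some v => rw [nextPhase_of_seeds_some h]

theorem nextPhase_est (s : ElimState M N r) (m : ℕ) (E : PartialEstimate M N) :
    (nextPhase s m E).est = fun _ _ => none := by
  cases h : s.seeds with
  | none => rcases nextPhase_of_seeds_none (m := m) (E := E) h with ⟨v, -, he⟩ | ⟨-, he⟩ <;> rw [he]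
  | some v => rw [nextPhase_of_seeds_some h]

theorem elimStep_start (s : ElimState M N r) (seed : Seed) (noise : ℕ → Fin M → ℝ) :
    (elimStep O R seed noise s).start = s.start + O.rounds s.acc s.block.1 s.block.2 := by
  cases h : s.pending with
  | nil => rw [elimStep_of_pending_nil h, nextPhase_start]
  | cons b bs => rw [elimStep_of_pending_cons h]

theorem elimRun_start_succ (ω : RunSpace M N Seed) (n : ℕ) :
    (elimRun r O R ω (n + 1)).start = (elimRun r O R ω n).start +
      O.rounds (elimRun r O R ω n).acc (elimRun r O R ω n).block.1 (elimRun r O R ω n).block.2 :=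
  elimStep_start _ _ _

theorem strictMono_elimRun_start (ω : RunSpace M N Seed) :
    StrictMono fun n => (elimRun r O R ω n).start := by
  refine strictMono_nat_of_lt_succ fun n => ?_
  rw [elimRun_start_succ]
  exact Nat.lt_add_of_pos_right (O.rounds_pos _ _ _)

theorem callAt_eq {ω : RunSpace M N Seed} {t n : ℕ} (h1 : (elimRun r O R ω n).start ≤ t)
    (h2 : t < (elimRun r O R ω (n + 1)).start) : callAt r O R ω t = n := by
  have hm := strictMono_elimRun_start (r := r) (O := O) (R := R) ω
  refine Nat.findGreatest_eq_iff.2 ⟨(hm.id_le n).trans h1, fun _ => h1, fun k hk _ hle => ?_⟩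
  have := hm.monotone (Nat.succ_le_of_lt hk)
  simp only [Nat.succ_eq_add_one] at this
  omega

/-- The oracle call that starts in state `s` is accurate. Calls with invalid parameters, about
which nothing is guaranteed, count as accurate. -/
def AccurateCall (O : MCOracle M N Seed) (R : Matrix (Fin M) (Fin N) ℝ) (seed : Seed)
    (noise : ℕ → Fin M → ℝ) (start : ℕ) (acc : ℝ) (b : Finset (Fin M) × Finset (Fin N)) : Prop :=
  0 < acc → acc ≤ 1 → b.1.Nonempty → b.2.Nonempty → ∀ u ∈ b.1, ∀ x ∈ b.2,
    |O.estimateOf R acc b.1 b.2 seed (fun i u => noise (start + i) u) u x - R u x| ≤ acc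

/-- The regret per user in round `t`. -/
noncomputable def roundRegret (r : ℕ) (O : MCOracle M N Seed) (R : Matrix (Fin M) (Fin N) ℝ)
    (best : Fin M → Fin N) (ω : RunSpace M N Seed) (t : ℕ) : ℝ :=
  (1 / (M : ℝ)) * ∑ u, itemGap R best u (recommend r O R ω t u)

theorem regret_eq_sum_roundRegret [NeZero N] (π : Fin M → Equiv.Perm (Fin N)) (T : ℕ)
    (ω : RunSpace M N Seed) :
    regret r O R π T ω = ∑ t ∈ Finset.range T, roundRegret r O R (fun u => π u 0) ω t := by
  simp only [regret, roundRegret, itemGap, Finset.sum_sub_distrib, ← Finset.mul_sum]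

variable {best : Fin M → Fin N} {A : Finset (Fin N)} {Δ H W : ℝ} {ω : RunSpace M N Seed}

theorem HottInstance.users_pos (h : HottInstance R best A Δ H) : 0 < M := by
  obtain ⟨a, ha⟩ : A.Nonempty := Finset.card_pos.1 (by linarith [h.two_le_card])
  obtain ⟨u, -⟩ := h.separated a ha
  exact u.pos

theorem roundRegret_nonneg (h : HottInstance R best A Δ H) (t : ℕ) :
    0 ≤ roundRegret r O R best ω t :=
  mul_nonneg (by positivity) (Finset.sum_nonneg fun u _ => h.nonneg u _)

theorem roundRegret_le (h : HottInstance R best A Δ H) {t : ℕ} {w : ℝ}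
    (hw : ∀ u, itemGap R best u (recommend r O R ω t u) ≤ w) :
    roundRegret r O R best ω t ≤ w := by
  have hM : (0 : ℝ) < M := by exact_mod_cast h.users_pos
  have h1 : ∑ u, itemGap R best u (recommend r O R ω t u) ≤ M * w := by
    refine (Finset.sum_le_sum fun u _ => hw u).trans ?_
    simp
  unfold roundRegret
  rw [one_div, inv_mul_le_iff₀ hM]
  exact h1

theorem recommend_mem_shownItems {t n : ℕ} (h1 : (elimRun r O R ω n).start ≤ t)
    (h2 : t < (elimRun r O R ω (n + 1)).start)
    (hpick : ∀ t u S, S.Nonempty → ω.2.2 t u S ∈ S) (hb : (elimRun r O R ω n).block.2.Nonempty)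
    (hcand : ∀ u, ((elimRun r O R ω n).cand u).Nonempty) (u : Fin M) :
    recommend r O R ω t u ∈ shownItems (elimRun r O R ω n) u := by
  rw [elimRun_start_succ] at h2
  unfold recommend shownItems
  rw [callAt_eq h1 (by rw [elimRun_start_succ]; exact h2)]
  simp only
  split_ifs with hu
  · exact O.sample_mem _ _ _ _ _ _ hb hu (by omega)
  · exact hpick t u _ (hcand u)

variable [NeZero N]

theorem runInvariant_elimRun (h : HottInstance R best A Δ H) (hA : A.card = r) (hW : 0 ≤ W)
    (hpick : ∀ t u S, S.Nonempty → ω.2.2 t u S ∈ S)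
    (hrounds : ∀ (η : ℝ) (rows : Finset (Fin M)) (cols : Finset (Fin N)), 0 < η → η ≤ 1 →
      (∃ a ∈ A, ∀ u, best u = a → u ∈ rows) → cols.Nonempty →
      (O.rounds η rows cols : ℝ) ≤ W / η ^ 2) (T : ℕ)
    (hgood : ∀ n < T, AccurateCall O R (ω.1 n) ω.2.1 (elimRun r O R ω n).start
      (elimRun r O R ω n).acc (elimRun r O R ω n).block) :
    ∀ n ≤ T, RunInvariant R best A Δ H W (elimRun r O R ω n)
      (∑ t ∈ Finset.range (elimRun r O R ω n).start, roundRegret r O R best ω t) := by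
  intro n hn
  induction n with
  | zero => simpa [elimRun, initState] using RunInvariant.initState (r := r) h hW
  | succ n ih =>
    have hI := ih (by omega)
    have hb := hI.block_nonempty
    obtain ⟨a, ha, hcl⟩ := hI.cluster_subset_block h
    obtain ⟨u, hu, -⟩ := h.separated a ha
    obtain ⟨hc, hc1⟩ := hI.acc_mem
    refine hI.elimStep h hA hW (hgood n (by omega) hc hc1 ⟨u, hcl u hu⟩ hb)
      (hrounds _ _ _ hc hc1 ⟨a, ha, hcl⟩ hb) fun w hw => ?_
    rw [elimRun_start_succ, Finset.sum_range_add]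
    gcongr
    refine (Finset.sum_le_sum (g := fun _ => w) fun i hi => roundRegret_le h fun u => ?_).trans ?_
    · refine hw u _ (recommend_mem_shownItems (Nat.le_add_right _ _) ?_ hpick hb
        hI.cand_nonempty u)
      rw [elimRun_start_succ]
      have := Finset.mem_range.1 hi
      omega
    · simp

/-- If the calls that can take place in the first `T` rounds are accurate, the regret is small. -/
theorem regret_le_of_accurate {π : Fin M → Equiv.Perm (Fin N)}
    (h : HottInstance R (fun u => π u 0) A Δ H) (hA : A.card = r) (hW : 0 ≤ W)
    (hpick : ∀ t u S, S.Nonempty → ω.2.2 t u S ∈ S)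
    (hrounds : ∀ (η : ℝ) (rows : Finset (Fin M)) (cols : Finset (Fin N)), 0 < η → η ≤ 1 →
      (∃ a ∈ A, ∀ u, π u 0 = a → u ∈ rows) → cols.Nonempty →
      (O.rounds η rows cols : ℝ) ≤ W / η ^ 2) {T : ℕ}
    (hgood : ∀ n < T, AccurateCall O R (ω.1 n) ω.2.1 (elimRun r O R ω n).start
      (elimRun r O R ω n).acc (elimRun r O R ω n).block) :
    regret r O R π T ω ≤ 120000 * W / H ^ 2 + 2352 * r * W / Δ := by
  have hI := runInvariant_elimRun h hA hW hpick hrounds T hgood T le_rfl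
  refine le_trans ?_ (hI.cost_le h hW)
  rw [regret_eq_sum_roundRegret]
  exact Finset.sum_le_sum_of_subset_of_nonneg
    (Finset.range_mono ((strictMono_elimRun_start ω).id_le T))
    fun t _ _ => roundRegret_nonneg h t

end Run

/-! ### Measurable maps with countably many values -/

section Countable

variable {Ω α β γ : Type*} [MeasurableSpace Ω]

/-- The map `f` takes countably many values, each on a measurable set. The discrete data of the
algorithm (including the accuracies, which are real numbers) are of this kind. The point is
`measurableSet_bind`: functions of such data need not be measurable in them. -/
structure CountableMeasurable (f : Ω → α) : Prop where
  countable : (Set.range f).Countable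
  fiber : ∀ a, MeasurableSet (f ⁻¹' {a})

namespace CountableMeasurable

theorem measurableSet_bind {f : Ω → α} (hf : CountableMeasurable f) {P : α → Ω → Prop}
    (hP : ∀ a, MeasurableSet {ω | P a ω}) : MeasurableSet {ω | P (f ω) ω} := by
  have : {ω | P (f ω) ω} = ⋃ a ∈ Set.range f, f ⁻¹' {a} ∩ {ω | P a ω} := by
    ext ω
    simp only [Set.mem_iUnion, exists_prop]
    refine ⟨fun h => ⟨f ω, ⟨ω, rfl⟩, rfl, h⟩, ?_⟩
    rintro ⟨a, -, ha, h⟩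
    have ha' : f ω = a := ha
    subst ha'
    exact h
  rw [this]
  exact MeasurableSet.biUnion hf.countable fun a _ => (hf.fiber a).inter (hP a)

theorem measurable_bind [MeasurableSpace β] {f : Ω → α} (hf : CountableMeasurable f)
    {h : α → Ω → β} (hh : ∀ a, Measurable (h a)) : Measurable fun ω => h (f ω) ω :=
  fun s hs => hf.measurableSet_bind (P := fun a ω => h a ω ∈ s) fun a => hh a hs

theorem bind {f : Ω → α} (hf : CountableMeasurable f) {h : α → Ω → β}
    (hh : ∀ a, CountableMeasurable (h a)) : CountableMeasurable fun ω => h (f ω) ω := by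
  refine ⟨(hf.countable.biUnion fun a _ => (hh a).countable).mono ?_,
    fun b => hf.measurableSet_bind (P := fun a ω => h a ω = b) fun a => (hh a).fiber b⟩
  rintro _ ⟨ω, rfl⟩
  exact Set.mem_biUnion ⟨ω, rfl⟩ ⟨ω, rfl⟩

theorem const (a : α) : CountableMeasurable fun _ : Ω => a := by
  refine ⟨(Set.countable_singleton a).mono ?_, fun b => MeasurableSet.const (a = b)⟩
  rintro _ ⟨ω, rfl⟩
  rfl

theorem comp {f : Ω → α} (hf : CountableMeasurable f) (g : α → β) :
    CountableMeasurable fun ω => g (f ω) :=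
  hf.bind fun a => const (g a)

theorem prodMk {f : Ω → α} {g : Ω → β} (hf : CountableMeasurable f) (hg : CountableMeasurable g) :
    CountableMeasurable fun ω => (f ω, g ω) :=
  hf.bind (h := fun a ω => (a, g ω)) fun a => hg.comp fun b => (a, b)

theorem of_factor {f : Ω → α} (hf : CountableMeasurable f) {g : Ω → β}
    (h : ∀ ω ω', f ω = f ω' → g ω = g ω') : CountableMeasurable g := by
  rcases isEmpty_or_nonempty Ω with _ | ⟨⟨ω₀⟩⟩
  · exact ⟨by rw [Set.range_eq_empty]; exact Set.countable_empty, fun b => by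
      rw [Set.eq_empty_of_isEmpty (g ⁻¹' {b})]
      exact MeasurableSet.empty⟩
  · have : Nonempty β := ⟨g ω₀⟩
    obtain ⟨e, he⟩ := (Function.factorsThrough_iff (f := f) g).1 fun ω ω' => h ω ω'
    rw [he]
    exact hf.comp e

theorem of_measurableSet {P : Ω → Prop} (h : MeasurableSet {ω | P ω}) : CountableMeasurable P :=
  ⟨Set.to_countable _, fun a => by
    by_cases ha : a
    · convert h using 1
      ext ω
      simp [ha]
    · convert h.compl using 1
      ext ω
      simp [ha]⟩

theorem pi {ι : Type*} [Finite ι] {f : ι → Ω → α} (hf : ∀ i, CountableMeasurable (f i)) :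
    CountableMeasurable fun ω i => f i ω := by
  refine ⟨(Set.countable_univ_pi fun i => (hf i).countable).mono ?_, fun a => ?_⟩
  · rintro _ ⟨ω, rfl⟩ i -
    exact ⟨ω, rfl⟩
  · have : (fun ω i => f i ω) ⁻¹' {a} = ⋂ i, f i ⁻¹' {a i} := by
      ext ω
      simp [funext_iff]
    rw [this]
    exact MeasurableSet.iInter fun i => (hf i).fiber _

end CountableMeasurable

end Countable

/-! ### Measurability of the run -/

section Measurability

variable {Ω : Type*} [MeasurableSpace Ω] {M N r : ℕ} {Seed : Type*} [MeasurableSpace Seed]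
  {O : MCOracle M N Seed} {R : Matrix (Fin M) (Fin N) ℝ}

/-- The components of a state other than the estimates. -/
def ElimState.data (s : ElimState M N r) :
    ℕ × ℝ × (Fin M → Finset (Fin N)) × Option (Fin r → Fin M) ×
      (Finset (Fin M) × Finset (Fin N)) × List (Finset (Fin M) × Finset (Fin N)) :=
  (s.start, s.acc, s.cand, s.seeds, s.block, s.pending)

/-- A random partial estimate is measurable: the set of its known entries and their values are. -/
def MeasurableEstimate (E : Ω → PartialEstimate M N) : Prop :=
  ∀ u x, MeasurableSet {ω | E ω u x = none} ∧ Measurable fun ω => (E ω u x).getD 0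

/-- A random state of the algorithm is measurable. -/
structure MeasurableState (s : Ω → ElimState M N r) : Prop where
  data : CountableMeasurable fun ω => (s ω).data
  est : MeasurableEstimate fun ω => (s ω).est

theorem CountableMeasurable.measurableEstimate_bind {α : Type*} {f : Ω → α}
    (hf : CountableMeasurable f) {E : α → Ω → PartialEstimate M N}
    (hE : ∀ a, MeasurableEstimate (E a)) : MeasurableEstimate fun ω => E (f ω) ω := fun u x =>
  ⟨hf.measurableSet_bind (P := fun a ω => E a ω u x = none) fun a => (hE a u x).1,
    hf.measurable_bind (h := fun a ω => (E a ω u x).getD 0) fun a => (hE a u x).2⟩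

theorem measurableEstimate_none :
    MeasurableEstimate fun _ : Ω => (fun _ _ => none : PartialEstimate M N) :=
  fun _ _ => ⟨MeasurableSet.const _, measurable_const⟩

theorem MeasurableEstimate.measurableSet_estimatedWithin {E : Ω → PartialEstimate M N}
    (hE : MeasurableEstimate E) (l : ℝ) (u : Fin M) (x : Fin N) :
    MeasurableSet {ω | EstimatedWithin (E ω) l u x} := by
  have : {ω | EstimatedWithin (E ω) l u x} = {ω | E ω u x = none}ᶜ ∩
      ⋂ y, ({ω | E ω u y = none} ∪ {ω | (E ω u y).getD 0 - (E ω u x).getD 0 ≤ l}) := by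
    ext ω
    simp only [Set.mem_ofPred_eq, Set.mem_inter_iff, Set.mem_compl_iff, Set.mem_iInter,
      Set.mem_union]
    constructor
    · rintro ⟨a, ha, h⟩
      refine ⟨by simp [ha], fun y => ?_⟩
      cases hy : E ω u y with
      | none => exact Or.inl rfl
      | some b => exact Or.inr (by simpa [ha] using h y b hy)
    · rintro ⟨h1, h2⟩
      obtain ⟨a, ha⟩ := Option.ne_none_iff_exists'.1 h1
      refine ⟨a, ha, fun y b hb => ?_⟩
      simpa [ha, hb] using h2 y
  rw [this]
  exact (hE u x).1.compl.inter (MeasurableSet.iInter fun y => (hE u y).1.union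
    (measurableSet_le ((hE u y).2.sub (hE u x).2) measurable_const))

theorem measurable_estimateOf {seed : Ω → Seed} {noise : Ω → ℕ → Fin M → ℝ}
    (hs : Measurable seed) (hn : Measurable noise) (start : ℕ) (η : ℝ) (rows : Finset (Fin M))
    (cols : Finset (Fin N)) (u : Fin M) (x : Fin N) :
    Measurable fun ω =>
      O.estimateOf R η rows cols (seed ω) (fun i u => noise ω (start + i) u) u x := by
  unfold MCOracle.estimateOf
  refine (O.measurable_estimate η rows cols u x).comp (hs.prodMk ?_)
  refine measurable_pi_lambda _ fun i => measurable_pi_lambda _ fun w => ?_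
  refine Measurable.add ?_ ?_
  · exact (Measurable.of_discrete (f := fun y => R w y)).comp
      ((O.measurable_sample η rows cols i w).comp hs)
  · exact (measurable_pi_apply _).comp ((measurable_pi_apply _).comp hn)

theorem MeasurableState.estimateAfter {s : Ω → ElimState M N r} (h : MeasurableState s)
    {seed : Ω → Seed} {noise : Ω → ℕ → Fin M → ℝ}
    (hs : Measurable seed) (hn : Measurable noise) :
    MeasurableEstimate fun ω => estimateAfter O R (seed ω) (noise ω) (s ω) := by
  refine h.data.measurableEstimate_bind (E := fun d ω => recordBlock (s ω).est
    (O.estimateOf R d.2.1 d.2.2.2.2.1.1 d.2.2.2.2.1.2 (seed ω)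
      fun i u => noise ω (d.1 + i) u) d.2.2.2.2.1) fun d u x => ?_
  simp only [recordBlock]
  split_ifs
  · exact ⟨by simp, by simpa using measurable_estimateOf hs hn _ _ _ _ u x⟩
  · exact h.est u x

theorem nextPhase_data_congr {s s' : ElimState M N r} {m : ℕ} {E E' : PartialEstimate M N}
    (hd : s.data = s'.data)
    (h3 : (fun u x => EstimatedWithin E (3 * s.acc) u x) =
      fun u x => EstimatedWithin E' (3 * s'.acc) u x)
    (h12 : (fun u x => EstimatedWithin E (12 * s.acc) u x) =
      fun u x => EstimatedWithin E' (12 * s'.acc) u x) :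
    (nextPhase s m E).data = (nextPhase s' m E').data := by
  obtain ⟨start, acc, cand, seeds, est, block, pending⟩ := s
  obtain ⟨start', acc', cand', seeds', est', block', pending'⟩ := s'
  simp only [ElimState.data, Prod.mk.injEq] at hd
  obtain ⟨rfl, rfl, rfl, rfl, rfl, rfl⟩ := hd
  simp only at h3 h12
  have h3' : ∀ u x, EstimatedWithin E (3 * acc) u x ↔ EstimatedWithin E' (3 * acc) u x :=
    fun u x => iff_of_eq (congrFun₂ h3 u x)
  have h12' : ∀ u x, EstimatedWithin E (12 * acc) u x ↔ EstimatedWithin E' (12 * acc) u x :=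
    fun u x => iff_of_eq (congrFun₂ h12 u x)
  have hp : pruneItems E (3 * acc) cand = pruneItems E' (3 * acc) cand := by
    funext u
    ext x
    rw [mem_pruneItems, mem_pruneItems, h3']
  have hi : ∀ (c : Fin M → Finset (Fin N)) (v : Fin r → Fin M) i,
      groupItems E (12 * acc) c v i = groupItems E' (12 * acc) c v i := by
    intro c v i
    ext x
    simp only [groupItems, Finset.mem_filter, h12']
  have he : ∀ (c : Fin M → Finset (Fin N)) (v : Fin r → Fin M),
      expandItems E (12 * acc) c v = expandItems E' (12 * acc) c v := by
    intro c v
    funext u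
    ext x
    unfold expandItems
    split_ifs
    · simp only [Finset.mem_filter, h12', hi]
    · rfl
  have hu : ∀ (c : Fin M → Finset (Fin N)) (v : Fin r → Fin M) i,
      groupUsers E (12 * acc) c v i = groupUsers E' (12 * acc) c v i := by
    intro c v i
    simp only [groupUsers, he, hi]
  cases seeds with
  | none =>
    unfold nextPhase
    dsimp only
    rw [hp]
  | some v => simp only [nextPhase, hp, hi, he, hu, ElimState.data]

theorem elimStep_est (s : ElimState M N r) (seed : Seed) (noise : ℕ → Fin M → ℝ) :
    (elimStep O R seed noise s).est =
      if s.pending = [] then fun _ _ => none else estimateAfter O R seed noise s := by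
  cases h : s.pending with
  | nil => rw [elimStep_of_pending_nil h, nextPhase_est, if_pos rfl]
  | cons b bs => rw [elimStep_of_pending_cons h, if_neg (by simp)]

theorem MeasurableState.elimStep {s : Ω → ElimState M N r} (h : MeasurableState s)
    {seed : Ω → Seed} {noise : Ω → ℕ → Fin M → ℝ}
    (hs : Measurable seed) (hn : Measurable noise) :
    MeasurableState fun ω => elimStep O R (seed ω) (noise ω) (s ω) := by
  have hE := h.estimateAfter (O := O) (R := R) hs hn
  have hw : ∀ k : ℝ, CountableMeasurable fun ω u x =>
      EstimatedWithin (_root_.estimateAfter O R (seed ω) (noise ω) (s ω)) (k * (s ω).acc) u x :=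
    fun k => .pi fun u => .pi fun x => h.data.bind (h := fun d ω =>
      EstimatedWithin (_root_.estimateAfter O R (seed ω) (noise ω) (s ω)) (k * d.2.1) u x)
      fun d => .of_measurableSet (hE.measurableSet_estimatedWithin _ u x)
  constructor
  · refine (h.data.prodMk ((hw 3).prodMk (hw 12))).of_factor fun ω ω' heq => ?_
    obtain ⟨hd, h3, h12⟩ : _ ∧ _ ∧ _ := by simpa only [Prod.mk.injEq] using heq
    have hd' := hd
    simp only [ElimState.data, Prod.mk.injEq] at hd'
    obtain ⟨e1, e2, e3, e4, e5, e6⟩ := hd'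
    cases hp : (s ω).pending with
    | nil =>
      rw [elimStep_of_pending_nil hp, elimStep_of_pending_nil (e6 ▸ hp), e1, e2, e5]
      exact nextPhase_data_congr hd h3 h12
    | cons b bs =>
      rw [elimStep_of_pending_cons hp, elimStep_of_pending_cons (e6 ▸ hp)]
      simp only [ElimState.data, e1, e2, e3, e4, e5]
  · simp only [elimStep_est]
    refine h.data.measurableEstimate_bind (E := fun d ω =>
      if d.2.2.2.2.2 = [] then fun _ _ => none
      else _root_.estimateAfter O R (seed ω) (noise ω) (s ω)) fun d => ?_
    split_ifs
    · exact measurableEstimate_none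
    · exact hE

theorem measurableState_elimRun {f : Ω → RunSpace M N Seed} (hf : Measurable f) (n : ℕ) :
    MeasurableState fun ω => elimRun r O R (f ω) n := by
  induction n with
  | zero => exact ⟨.const (initState (M := M) (N := N) (r := r)).data, measurableEstimate_none⟩
  | succ n ih =>
    exact ih.elimStep ((measurable_pi_apply n).comp hf.fst) hf.snd.fst

theorem measurable_recommend (t : ℕ) (u : Fin M) :
    Measurable fun ω : RunSpace M N Seed => recommend r O R ω t u := by
  have hst := fun n => measurableState_elimRun (r := r) (O := O) (R := R)
    (f := fun ω : RunSpace M N Seed => ω) measurable_id n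
  have hcall : CountableMeasurable fun ω : RunSpace M N Seed => callAt r O R ω t := by
    refine (CountableMeasurable.pi (ι := Fin (t + 1))
      fun i => (hst i).data.comp fun d => d.1).of_factor fun ω ω' heq => ?_
    have h : ∀ n ≤ t, (elimRun r O R ω n).start = (elimRun r O R ω' n).start := fun n hn =>
      congrFun heq ⟨n, Nat.lt_succ_of_le hn⟩
    unfold callAt
    rw [Nat.findGreatest_eq_iff]
    obtain ⟨h1, h2, h3⟩ := (Nat.findGreatest_eq_iff (P := fun n => (elimRun r O R ω' n).start ≤ t)
      (k := t)).1 rfl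
    exact ⟨h1, fun h0 => by rw [h _ h1]; exact h2 h0, fun n hn hnt => by
      rw [h _ hnt]; exact h3 hn hnt⟩
  unfold recommend
  refine hcall.measurable_bind (h := fun n ω => if u ∈ (elimRun r O R ω n).block.1 then
      O.sample (elimRun r O R ω n).acc (elimRun r O R ω n).block.1 (elimRun r O R ω n).block.2
        (ω.1 n) (t - (elimRun r O R ω n).start) u
    else ω.2.2 t u ((elimRun r O R ω n).cand u)) fun n => ?_
  refine (hst n).data.measurable_bind (h := fun d ω => if u ∈ d.2.2.2.2.1.1 then
      O.sample d.2.1 d.2.2.2.2.1.1 d.2.2.2.2.1.2 (ω.1 n) (t - d.1) u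
    else ω.2.2 t u (d.2.2.1 u)) fun d => ?_
  split_ifs
  · exact (O.measurable_sample _ _ _ _ _).comp ((measurable_pi_apply n).comp measurable_fst)
  · exact (measurable_pi_apply _).comp ((measurable_pi_apply _).comp
      ((measurable_pi_apply _).comp measurable_snd.snd))

theorem measurable_regret [NeZero N] (π : Fin M → Equiv.Perm (Fin N)) (T : ℕ) :
    Measurable (regret (Seed := Seed) r O R π T) := by
  unfold regret
  refine (measurable_const.sub (Finset.measurable_fun_sum _ fun t _ =>
    Finset.measurable_fun_sum _ fun u _ => ?_)).const_mul _
  exact (Measurable.of_discrete (f := fun y => R u y)).comp (measurable_recommend t u)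

theorem measurableSet_accurateCall {seed : Ω → Seed} {noise : Ω → ℕ → Fin M → ℝ}
    (hs : Measurable seed) (hn : Measurable noise) (start : ℕ) (acc : ℝ)
    (b : Finset (Fin M) × Finset (Fin N)) :
    MeasurableSet {ω | AccurateCall O R (seed ω) (noise ω) start acc b} := by
  rw [measurableSet_setOfPred]
  unfold AccurateCall
  refine measurable_const.imp (measurable_const.imp (measurable_const.imp (measurable_const.imp
    (Measurable.forall fun u => measurable_const.imp (Measurable.forall fun x =>
      measurable_const.imp ?_)))))
  rw [← measurableSet_setOfPred]
  exact measurableSet_le (((measurable_estimateOf hs hn start acc b.1 b.2 u x).sub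
    measurable_const).abs) measurable_const

theorem measurableSet_accurateCall_elimRun {f : Ω → RunSpace M N Seed} (hf : Measurable f)
    (n : ℕ) :
    MeasurableSet {ω | AccurateCall O R ((f ω).1 n) (f ω).2.1 (elimRun r O R (f ω) n).start
      (elimRun r O R (f ω) n).acc (elimRun r O R (f ω) n).block} :=
  (measurableState_elimRun hf n).data.measurableSet_bind
    (P := fun d ω => AccurateCall O R ((f ω).1 n) (f ω).2.1 d.1 d.2.1 d.2.2.2.2.1)
    fun _ => measurableSet_accurateCall ((measurable_pi_apply n).comp hf.fst) hf.snd.fst _ _ _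

end Measurability

/-! ### Splicing independent sequences -/

section Splice

open Measure

variable {X : Type*}

/-- The sequence that follows `a` before time `m`, and then starts with `b`. -/
def splice (m : ℕ) (a b : ℕ → X) : ℕ → X := fun i => if i < m then a i else b (i - m)

theorem splice_of_lt {m i : ℕ} (h : i < m) (a b : ℕ → X) : splice m a b i = a i := if_pos h

theorem splice_add (m i : ℕ) (a b : ℕ → X) : splice m a b (m + i) = b i := by
  simp [splice]

/-- For i.i.d. sequences the past and the future of a time are independent, and the future
is again an i.i.d. sequence with the same law. -/
theorem measurePreserving_splice [MeasurableSpace X] (P : Measure X) [IsProbabilityMeasure P] (m : ℕ) :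
    MeasurePreserving (fun q : (ℕ → X) × (ℕ → X) => splice m q.1 q.2)
      ((infinitePi fun _ => P).prod (infinitePi fun _ => P)) (infinitePi fun _ => P) := by
  have hmeas : Measurable fun q : (ℕ → X) × (ℕ → X) => splice m q.1 q.2 := by
    refine measurable_pi_lambda _ fun i => ?_
    unfold splice
    split_ifs
    · exact (measurable_pi_apply i).comp measurable_fst
    · exact (measurable_pi_apply _).comp measurable_snd
  refine ⟨hmeas, eq_infinitePi _ fun s t ht => ?_⟩
  rw [map_apply hmeas (MeasurableSet.pi s.countable_toSet fun i _ => ht i)]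
  have hpre : (fun q : (ℕ → X) × (ℕ → X) => splice m q.1 q.2) ⁻¹' (s : Set ℕ).pi t =
      ((s.filter (· < m) : Finset ℕ) : Set ℕ).pi t ×ˢ
        (((s.filter (¬ · < m)).image (· - m) : Finset ℕ) : Set ℕ).pi fun j => t (j + m) := by
    ext q
    simp only [Set.mem_preimage, Set.mem_pi, Finset.mem_coe, Set.mem_prod, Finset.mem_filter,
      Finset.mem_image, splice]
    constructor
    · refine fun h => ⟨fun i hi => by simpa [hi.2] using h i hi.1, ?_⟩
      rintro _ ⟨i, ⟨hi, him⟩, rfl⟩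
      have := h i hi
      rw [if_neg him] at this
      rwa [Nat.sub_add_cancel (not_lt.1 him)]
    · rintro ⟨h1, h2⟩ i hi
      split_ifs with him
      · exact h1 i ⟨hi, him⟩
      · have := h2 (i - m) ⟨i, ⟨hi, him⟩, rfl⟩
        rwa [Nat.sub_add_cancel (not_lt.1 him)] at this
  rw [hpre, prod_prod, infinitePi_pi _ fun i _ => ht i, infinitePi_pi _ fun i _ => ht _,
    Finset.prod_image, ← Finset.prod_filter_mul_prod_filter_not s (· < m)]
  · congr 1
    refine Finset.prod_congr rfl fun i hi => ?_
    rw [Nat.sub_add_cancel (not_lt.1 (Finset.mem_filter.1 hi).2)]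
  · intro i hi j hj hij
    have h1 := (Finset.mem_filter.1 hi).2
    have h2 := (Finset.mem_filter.1 hj).2
    simp only at hij
    omega

/-- Regrouping of a product of four measures. -/
theorem measurePreserving_prod_comm_middle {α β γ δ : Type*} [MeasurableSpace α]
    [MeasurableSpace β] [MeasurableSpace γ] [MeasurableSpace δ] (μa : Measure α) (μb : Measure β)
    (μc : Measure γ) (μd : Measure δ) [SFinite μa] [SFinite μb] [SFinite μc] [SFinite μd] :
    MeasurePreserving (fun p : (α × β) × (γ × δ) => ((p.1.1, p.2.1), (p.1.2, p.2.2)))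
      ((μa.prod μb).prod (μc.prod μd)) ((μa.prod μc).prod (μb.prod μd)) := by
  have h1 := measurePreserving_prodAssoc μa μb (μc.prod μd)
  have h2 := (measurePreserving_prodAssoc μb μc μd).symm
  have h3 := (measurePreserving_swap (μ := μb) (ν := μc)).prod (MeasurePreserving.id μd)
  have h4 := measurePreserving_prodAssoc μc μb μd
  have h5 := (measurePreserving_prodAssoc μa μc (μb.prod μd)).symm
  exact h5.comp (((MeasurePreserving.id μa).prod (h4.comp (h3.comp h2))).comp h1)

end Splice

/-! ### The probability of an inaccurate call -/

section Probability

open Measure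

variable {M N r : ℕ} {Seed : Type*} [MeasurableSpace Seed] {O : MCOracle M N Seed}
  {R : Matrix (Fin M) (Fin N) ℝ}

theorem estimateOf_congr {η : ℝ} {rows : Finset (Fin M)} {cols : Finset (Fin N)} {seed : Seed}
    {z z' : ℕ → Fin M → ℝ} (h : ∀ i < O.rounds η rows cols, z i = z' i) :
    O.estimateOf R η rows cols seed z = O.estimateOf R η rows cols seed z' := by
  unfold MCOracle.estimateOf
  congr 1
  funext i u
  rw [h i i.2]

/-- The state before the `n`-th call depends only on the seeds of the earlier calls and on
the noise of the rounds before the call. -/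
theorem elimRun_congr {ω ω' : RunSpace M N Seed} (n : ℕ) (hs : ∀ i < n, ω.1 i = ω'.1 i)
    (hn : ∀ t < (elimRun r O R ω n).start, ω.2.1 t = ω'.2.1 t) :
    elimRun r O R ω n = elimRun r O R ω' n := by
  induction n with
  | zero => rfl
  | succ n ih =>
    rw [elimRun_start_succ] at hn
    have h := ih (fun i hi => hs i (by omega)) fun t ht => hn t (by omega)
    have he := estimateOf_congr (O := O) (R := R) (seed := ω.1 n)
      (z := fun i u => ω.2.1 ((elimRun r O R ω n).start + i) u)
      (z' := fun i u => ω'.2.1 ((elimRun r O R ω n).start + i) u)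
      (fun i hi => hn _ (Nat.add_lt_add_left hi _))
    simp only [elimRun]
    rw [← h, ← hs n (Nat.lt_succ_self n)]
    simp only [elimStep]
    rw [he]

/-- The marginal law of the seeds and the noise. -/
noncomputable def seedNoiseLaw (O : MCOracle M N Seed) (ν : Measure ℝ) [IsProbabilityMeasure ν] :
    Measure ((ℕ → Seed) × (ℕ → Fin M → ℝ)) :=
  (infinitePi fun _ : ℕ => O.seedLaw).prod (infinitePi fun _ : ℕ => Measure.pi fun _ : Fin M => ν)

instance (ν : Measure ℝ) [IsProbabilityMeasure ν] : IsProbabilityMeasure (seedNoiseLaw O ν) := by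
  unfold seedNoiseLaw
  infer_instance

theorem seedNoiseLaw_not_accurateCall_le {ν : Measure ℝ} [IsProbabilityMeasure ν]
    {B δ : ℝ} (hO : O.Guarantee R ν B δ) (acc : ℝ)
    (b : Finset (Fin M) × Finset (Fin N)) :
    seedNoiseLaw O ν {q | ¬ AccurateCall O R (q.1 0) q.2 0 acc b} ≤ ENNReal.ofReal δ := by
  by_cases hv : 0 < acc ∧ acc ≤ 1 ∧ b.1.Nonempty ∧ b.2.Nonempty
  · obtain ⟨h1, h2, h3, h4⟩ := hv
    have hmp : MeasurePreserving (fun q : (ℕ → Seed) × (ℕ → Fin M → ℝ) => (q.1 0, q.2))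
        (seedNoiseLaw O ν)
        (O.seedLaw.prod (infinitePi fun _ : ℕ => Measure.pi fun _ : Fin M => ν)) :=
      (measurePreserving_eval_infinitePi (fun _ : ℕ => O.seedLaw) 0).prod (MeasurePreserving.id _)
    have hset : {q : (ℕ → Seed) × (ℕ → Fin M → ℝ) | ¬ AccurateCall O R (q.1 0) q.2 0 acc b} =
        (fun q : (ℕ → Seed) × (ℕ → Fin M → ℝ) => (q.1 0, q.2)) ⁻¹'
          {p | ¬ AccurateCall O R p.1 p.2 0 acc b} := rfl
    have hm : MeasurableSet {p : Seed × (ℕ → Fin M → ℝ) | ¬ AccurateCall O R p.1 p.2 0 acc b} :=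
      (measurableSet_accurateCall measurable_fst measurable_snd _ _ _).compl
    rw [hset, hmp.measure_preimage hm.nullMeasurableSet]
    refine (measure_mono ?_).trans (hO.accurate acc b.1 b.2 h1 h2 h3 h4)
    intro p hp
    by_contra hne
    refine hp fun _ _ _ _ u hu x hx => not_lt.1 fun hlt => hne ⟨u, hu, x, hx, ?_⟩
    simpa using hlt
  · have hset : {q : (ℕ → Seed) × (ℕ → Fin M → ℝ) | ¬ AccurateCall O R (q.1 0) q.2 0 acc b} = ∅ :=
      Set.eq_empty_of_forall_notMem fun q hq =>
        hq fun h1 h2 h3 h4 => absurd ⟨h1, h2, h3, h4⟩ hv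
    rw [hset, measure_empty]
    exact zero_le

theorem ae_mem_pickLaw {S : Finset (Fin N)} (hS : S.Nonempty) : ∀ᵐ x ∂pickLaw S, x ∈ S := by
  unfold pickLaw
  rw [if_pos hS, uniformOn]
  exact ae_cond_mem (S.measurableSet)

variable [NeZero N] {ν : Measure ℝ} [IsProbabilityMeasure ν]

instance : IsProbabilityMeasure (runLaw O ν) := by
  unfold runLaw
  infer_instance

theorem measurePreserving_seedNoise :
    MeasurePreserving (fun ω : RunSpace M N Seed => (ω.1, ω.2.1)) (runLaw O ν)
      (seedNoiseLaw O ν) :=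
  (MeasurePreserving.id _).prod measurePreserving_fst

/-- A run with the given seeds and noise. -/
def runOf (q : (ℕ → Seed) × (ℕ → Fin M → ℝ)) : RunSpace M N Seed := (q.1, q.2, fun _ _ _ => 0)

theorem measurable_runOf : Measurable (runOf (N := N) (Seed := Seed) (M := M)) :=
  measurable_fst.prodMk (measurable_snd.prodMk measurable_const)

/-- Given the start and the parameters of the `n`-th call, the call is inaccurate with the
probability granted by the oracle, since it uses a fresh seed and fresh noise. -/
theorem seedNoiseLaw_fiber_le {B δ : ℝ} (hO : O.Guarantee R ν B δ) (n m : ℕ) (acc : ℝ)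
    (b : Finset (Fin M) × Finset (Fin N)) :
    seedNoiseLaw O ν {q | ((elimRun r O R (runOf q) n).start, (elimRun r O R (runOf q) n).acc,
        (elimRun r O R (runOf q) n).block) = (m, acc, b) ∧ ¬ AccurateCall O R (q.1 n) q.2 m acc b} ≤
      seedNoiseLaw O ν {q | ((elimRun r O R (runOf q) n).start, (elimRun r O R (runOf q) n).acc,
        (elimRun r O R (runOf q) n).block) = (m, acc, b)} * ENNReal.ofReal δ := by
  have hJ := (measurePreserving_splice O.seedLaw n).prod
    (measurePreserving_splice (Measure.pi fun _ : Fin M => ν) m)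
  have hswap := measurePreserving_prod_comm_middle
    (infinitePi fun _ : ℕ => O.seedLaw) (infinitePi fun _ : ℕ => Measure.pi fun _ : Fin M => ν)
    (infinitePi fun _ : ℕ => O.seedLaw) (infinitePi fun _ : ℕ => Measure.pi fun _ : Fin M => ν)
  have hmp := hJ.comp hswap
  have hst := (measurableState_elimRun (r := r) (O := O) (R := R)
    (measurable_runOf (N := N) (Seed := Seed) (M := M)) n).data.comp
    fun d => (d.1, d.2.1, d.2.2.2.2.1)
  have hm1 := hst.fiber (m, acc, b)
  have hm2 : MeasurableSet {q : (ℕ → Seed) × (ℕ → Fin M → ℝ) |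
      ¬ AccurateCall O R (q.1 n) q.2 m acc b} :=
    (measurableSet_accurateCall ((measurable_pi_apply n).comp measurable_fst) measurable_snd
      _ _ _).compl
  have key := hmp.measure_preimage (hm1.inter hm2).nullMeasurableSet
  refine (key.symm.le.trans (measure_mono ?_)).trans (((prod_prod _ _).le).trans
    (mul_le_mul_right (seedNoiseLaw_not_accurateCall_le hO acc b) _))
  rintro ⟨⟨a, z⟩, ⟨a', z'⟩⟩ ⟨h1, h2⟩
  have h1' : ((elimRun r O R (runOf (splice n a a', splice m z z')) n).start,
      (elimRun r O R (runOf (splice n a a', splice m z z')) n).acc,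
      (elimRun r O R (runOf (splice n a a', splice m z z')) n).block) = (m, acc, b) := h1
  have h2' : ¬ AccurateCall O R (splice n a a' n) (splice m z z') m acc b := h2
  have hcongr : elimRun r O R (runOf (splice n a a', splice m z z')) n =
      elimRun r O R (runOf (a, z)) n := by
    refine elimRun_congr n (fun i hi => splice_of_lt hi a a') fun t ht => ?_
    rw [(Prod.mk.inj h1').1] at ht
    exact splice_of_lt ht z z'
  rw [hcongr] at h1'
  refine ⟨h1', fun hacc => h2' ?_⟩
  have e1 : splice n a a' n = a' 0 := by simpa using splice_add n 0 a a'
  rw [e1]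
  intro k1 k2 k3 k4 u hu x hx
  simpa [splice_add] using hacc k1 k2 k3 k4 u hu x hx

theorem runLaw_not_accurateCall_le {B δ : ℝ} (hO : O.Guarantee R ν B δ) (n : ℕ) :
    runLaw O ν {ω | ¬ AccurateCall O R (ω.1 n) ω.2.1 (elimRun r O R ω n).start
      (elimRun r O R ω n).acc (elimRun r O R ω n).block} ≤ ENNReal.ofReal δ := by
  have hset : {ω : RunSpace M N Seed | ¬ AccurateCall O R (ω.1 n) ω.2.1
      (elimRun r O R ω n).start (elimRun r O R ω n).acc (elimRun r O R ω n).block} =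
      (fun ω : RunSpace M N Seed => (ω.1, ω.2.1)) ⁻¹' {q | ¬ AccurateCall O R (q.1 n) q.2
        (elimRun r O R (runOf q) n).start (elimRun r O R (runOf q) n).acc
        (elimRun r O R (runOf q) n).block} := by
    ext ω
    have : elimRun r O R ω n = elimRun r O R (runOf (ω.1, ω.2.1)) n :=
      elimRun_congr n (fun _ _ => rfl) fun _ _ => rfl
    simp only [Set.mem_preimage, Set.mem_ofPred_eq, ← this]
  have hm : MeasurableSet {q : (ℕ → Seed) × (ℕ → Fin M → ℝ) | ¬ AccurateCall O R (q.1 n) q.2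
      (elimRun r O R (runOf q) n).start (elimRun r O R (runOf q) n).acc
      (elimRun r O R (runOf q) n).block} :=
    (measurableSet_accurateCall_elimRun measurable_runOf n).compl
  rw [hset, measurePreserving_seedNoise.measure_preimage hm.nullMeasurableSet]
  set F := fun q : (ℕ → Seed) × (ℕ → Fin M → ℝ) => ((elimRun r O R (runOf (N := N) q) n).start,
    (elimRun r O R (runOf (N := N) q) n).acc, (elimRun r O R (runOf (N := N) q) n).block) with hF
  have hFm : CountableMeasurable F := (measurableState_elimRun (r := r) (O := O) (R := R)
    (measurable_runOf (N := N) (Seed := Seed) (M := M)) n).data.comp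
    fun d => (d.1, d.2.1, d.2.2.2.2.1)
  have : Countable (Set.range F) := hFm.countable.to_subtype
  calc seedNoiseLaw O ν {q | ¬ AccurateCall O R (q.1 n) q.2 (F q).1 (F q).2.1 (F q).2.2}
      ≤ seedNoiseLaw O ν (⋃ d : Set.range F, {q | F q = (d.1.1, d.1.2.1, d.1.2.2) ∧
          ¬ AccurateCall O R (q.1 n) q.2 d.1.1 d.1.2.1 d.1.2.2}) :=
        measure_mono fun q hq => Set.mem_iUnion.2 ⟨⟨F q, q, rfl⟩, rfl, hq⟩
    _ ≤ ∑' d : Set.range F, seedNoiseLaw O ν {q | F q = (d.1.1, d.1.2.1, d.1.2.2) ∧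
          ¬ AccurateCall O R (q.1 n) q.2 d.1.1 d.1.2.1 d.1.2.2} := measure_iUnion_le _
    _ ≤ ∑' d : Set.range F, seedNoiseLaw O ν (F ⁻¹' {d.1}) * ENNReal.ofReal δ :=
        ENNReal.tsum_le_tsum fun d => seedNoiseLaw_fiber_le hO n d.1.1 d.1.2.1 d.1.2.2
    _ = (∑' d : Set.range F, seedNoiseLaw O ν (F ⁻¹' {d.1})) * ENNReal.ofReal δ :=
        ENNReal.tsum_mul_right
    _ ≤ 1 * ENNReal.ofReal δ := by
        refine mul_le_mul_left ?_ _
        rw [← measure_univ (μ := seedNoiseLaw O ν)]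
        refine tsum_measure_le_measure_univ (fun d => (hFm.fiber d.1).nullMeasurableSet) ?_
        intro d d' hdd
        refine Disjoint.aedisjoint (Set.disjoint_left.2 fun q hq hq' => hdd (Subtype.ext ?_))
        exact (show F q = d.1 from hq).symm.trans hq'
    _ = ENNReal.ofReal δ := one_mul _

theorem ae_pick_mem : ∀ᵐ ω ∂runLaw O ν, ∀ (t : ℕ) (u : Fin M) (S : Finset (Fin N)),
    S.Nonempty → ω.2.2 t u S ∈ S := by
  simp only [ae_all_iff]
  intro t u S hS
  have h1 : MeasurePreserving (fun ω : RunSpace M N Seed => ω.2.2) (runLaw O ν)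
      (infinitePi fun _ : ℕ => Measure.pi fun _ : Fin M =>
        Measure.pi fun S : Finset (Fin N) => pickLaw S) :=
    measurePreserving_snd.comp measurePreserving_snd
  have h2 := (measurePreserving_eval (fun S : Finset (Fin N) => pickLaw S) S).comp
    ((measurePreserving_eval (fun _ : Fin M => Measure.pi fun S : Finset (Fin N) => pickLaw S)
      u).comp ((measurePreserving_eval_infinitePi (fun _ : ℕ => Measure.pi fun _ : Fin M =>
        Measure.pi fun S : Finset (Fin N) => pickLaw S) t).comp h1))
  exact h2.quasiMeasurePreserving.ae (ae_mem_pickLaw hS)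

end Probability

/-! ### The instances of the theorem -/

section Instance

variable {M N r : ℕ} {R : Matrix (Fin M) (Fin N) ℝ} {U : Matrix (Fin M) (Fin r) ℝ}
  {V : Matrix (Fin N) (Fin r) ℝ} {A : Finset (Fin N)}

theorem convex_setOf_weights (V : Matrix (Fin N) (Fin r) ℝ) (A : Finset (Fin N)) (c : Prop) :
    Convex ℝ {y : Fin r → ℝ | ∃ (l : Fin N → ℝ) (l₀ : ℝ), (∀ b ∈ A, 0 ≤ l b) ∧ 0 ≤ l₀ ∧
      ∑ b ∈ A, l b + l₀ = 1 ∧ (c → l₀ = 0) ∧ y = ∑ b ∈ A, l b • V b} := by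
  rintro y ⟨l, l₀, h1, h2, h3, h4, rfl⟩ y' ⟨l', l₀', h1', h2', h3', h4', rfl⟩ s t hs ht hst
  refine ⟨fun b => s * l b + t * l' b, s * l₀ + t * l₀', fun b hb => ?_, by positivity, ?_,
    fun hc => by rw [h4 hc, h4' hc]; ring, ?_⟩
  · have := h1 b hb
    have := h1' b hb
    positivity
  · rw [Finset.sum_add_distrib, ← Finset.mul_sum, ← Finset.mul_sum]
    linear_combination s * h3 + t * h3' + hst
  · simp only [add_smul, mul_smul, Finset.sum_add_distrib, Finset.smul_sum]

/-- An item in the convex hull of the hott items and zero is given by weights of the hott items and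
a weight `l₀` of zero, which vanishes if zero is not needed. -/
theorem exists_weights (hV : HottItems V A) (c : Prop)
    (hc : c → ∀ j, V j ∈ convexHull ℝ ((fun a => V a) '' (A : Set (Fin N)))) (j : Fin N) :
    ∃ (l : Fin N → ℝ) (l₀ : ℝ), (∀ b ∈ A, 0 ≤ l b) ∧ 0 ≤ l₀ ∧ ∑ b ∈ A, l b + l₀ = 1 ∧
      (c → l₀ = 0) ∧ V j = ∑ b ∈ A, l b • V b := by
  classical
  have hvert : ∀ a ∈ A, ∃ (l : Fin N → ℝ) (l₀ : ℝ), (∀ b ∈ A, 0 ≤ l b) ∧ 0 ≤ l₀ ∧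
      ∑ b ∈ A, l b + l₀ = 1 ∧ (c → l₀ = 0) ∧ V a = ∑ b ∈ A, l b • V b := by
    intro a ha
    refine ⟨fun b => if b = a then 1 else 0, 0, fun b _ => ?_, le_rfl, ?_, fun _ => rfl, ?_⟩
    · simp only
      split_ifs <;> norm_num
    · simp [ha]
    · rw [Finset.sum_eq_single a (fun b _ hb => by simp [hb]) fun h => absurd ha h]
      simp
  by_cases hcc : c
  · refine convexHull_min ?_ (convex_setOf_weights V A c) (hc hcc j)
    rintro _ ⟨a, ha, rfl⟩
    exact hvert a ha
  · refine convexHull_min ?_ (convex_setOf_weights V A c) (hV.2 j)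
    rintro _ (⟨a, ha, rfl⟩ | rfl)
    · exact hvert a ha
    · exact ⟨0, 1, by simp, by simp, by simp, fun h => absurd h hcc, by simp⟩

theorem gap_decomposition (hR1 : ∀ u j, |R u j| ≤ 1) (hR : R = U * V.transpose)
    (hV : HottItems V A)
    (hconv : (∀ j, V j ∈ convexHull ℝ ((fun a => V a) '' (A : Set (Fin N)))) ∨ ∀ u j, 0 ≤ R u j)
    (best : Fin M → Fin N) (x : Fin N) :
    ∃ (l : Fin N → ℝ) (l₀ : ℝ), (∀ b ∈ A, 0 ≤ l b) ∧ 0 ≤ l₀ ∧ ∑ b ∈ A, l b + l₀ = 1 ∧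
      ∀ u, ∃ z, (∀ b ∈ A, itemGap R best u b ≤ z) ∧
        itemGap R best u x = ∑ b ∈ A, l b * itemGap R best u b + l₀ * z := by
  obtain ⟨l, l₀, h1, h2, h3, h4, h5⟩ := exists_weights hV
    (∀ j, V j ∈ convexHull ℝ ((fun a => V a) '' (A : Set (Fin N)))) id x
  have hdot : ∀ u j, R u j = U u ⬝ᵥ V j := by
    intro u j
    rw [hR]
    rfl
  have hx : ∀ u, R u x = ∑ b ∈ A, l b * R u b := by
    intro u
    rw [hdot, h5, dotProduct_sum]
    refine Finset.sum_congr rfl fun b _ => ?_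
    rw [dotProduct_smul, hdot, smul_eq_mul]
  have hgap : ∀ u, itemGap R best u x =
      ∑ b ∈ A, l b * itemGap R best u b + l₀ * R u (best u) := by
    intro u
    simp only [itemGap, mul_sub, Finset.sum_sub_distrib, ← Finset.sum_mul]
    rw [hx]
    linear_combination -(R u (best u)) * h3
  refine ⟨l, l₀, h1, h2, h3, fun u => ?_⟩
  by_cases hc : ∀ j, V j ∈ convexHull ℝ ((fun a => V a) '' (A : Set (Fin N)))
  · refine ⟨2, fun b _ => ?_, ?_⟩
    · have e1 := abs_le.1 (hR1 u b)
      have e2 := abs_le.1 (hR1 u (best u))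
      unfold itemGap
      linarith [e1.1, e2.2]
    · rw [hgap, h4 hc]
      ring
  · refine ⟨R u (best u), fun b _ => ?_, hgap u⟩
    have := (hconv.resolve_left hc) u b
    unfold itemGap
    linarith

variable [NeZero N] {π : Fin M → Equiv.Perm (Fin N)}

theorem hottInstance (hr : 2 ≤ r) {κ : ℝ} (hκ : 0 < κ) (hR1 : ∀ u j, |R u j| ≤ 1)
    (hR : R = U * V.transpose) (hrank : R.rank = r) (hV : HottItems V A)
    (hconv : (∀ j, V j ∈ convexHull ℝ ((fun a => V a) '' (A : Set (Fin N)))) ∨ ∀ u j, 0 ≤ R u j)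
    (hπ : IsRewardOrdering R π) (hcl : ∀ a ∈ A, κ * M / r ≤ ((userCluster π a).card : ℝ))
    (hgap : 0 < rewardGap R π) :
    HottInstance R (fun u => π u 0) A (rewardGap R π) (hottGap R π A) := by
  have hM : 2 ≤ M := by
    have := R.rank_le_card_height
    rw [hrank, Fintype.card_fin] at this
    omega
  have hN : 2 ≤ N := by
    have := R.rank_le_card_width
    rw [hrank, Fintype.card_fin] at this
    omega
  have hcard : 2 ≤ A.card := hV.1 ▸ hr
  have hnonneg : ∀ u x, 0 ≤ itemGap R (fun u => π u 0) u x := by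
    intro u x
    have := hπ u (Fin.zero_le ((π u).symm x))
    simp only [Equiv.apply_symm_apply] at this
    simp only [itemGap]
    linarith
  have hne : ∀ u x, x ≠ π u 0 → rewardGap R π ≤ itemGap R (fun u => π u 0) u x := by
    intro u x hx
    have h1 : rewardGap R π ≤ R u (π u 0) - R u (π u 1) :=
      ciInf_le (Set.finite_range _).bddBelow u
    have h0 : (π u).symm x ≠ 0 := by
      intro h
      rw [← h] at hx
      simp at hx
    have h2 : (1 : Fin N) ≤ (π u).symm x := by
      rw [Fin.le_def, Fin.val_one', Nat.mod_eq_of_lt (by omega)]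
      exact Nat.one_le_iff_ne_zero.2 fun h => h0 (Fin.ext (by simpa using h))
    have h3 := hπ u h2
    simp only [Equiv.apply_symm_apply] at h3
    simp only [itemGap]
    linarith
  have hdecomp := gap_decomposition hR1 hR hV hconv fun u => π u 0
  have hbest : ∀ u, π u 0 ∈ A := by
    intro u
    by_contra hnot
    obtain ⟨l, l₀, h1, h2, h3, h4⟩ := hdecomp (π u 0)
    obtain ⟨z, hz, he⟩ := h4 u
    obtain ⟨b, hb⟩ : A.Nonempty := Finset.card_pos.1 (by omega)
    have hΔ : ∀ b ∈ A, rewardGap R π ≤ itemGap R (fun u => π u 0) u b := fun b hb =>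
      hne u b fun h => hnot (h ▸ hb)
    have h5 : ∑ b ∈ A, l b * rewardGap R π ≤ ∑ b ∈ A, l b * itemGap R (fun u => π u 0) u b :=
      Finset.sum_le_sum fun b hb => mul_le_mul_of_nonneg_left (hΔ b hb) (h1 b hb)
    rw [← Finset.sum_mul] at h5
    have h6 := mul_le_mul_of_nonneg_left ((hΔ b hb).trans (hz b hb)) h2
    have h7 : itemGap R (fun u => π u 0) u (π u 0) = 0 :=
      itemGap_best (R := R) (best := fun u => π u 0) u
    have h8 : (∑ b ∈ A, l b) * rewardGap R π + l₀ * rewardGap R π = rewardGap R π := by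
      rw [← add_mul, h3, one_mul]
    linarith
  have hclne : ∀ a ∈ A, Nonempty {u : Fin M // u ∈ userCluster π a} := by
    intro a ha
    have h1 := hcl a ha
    have h2 : 0 < κ * M / r := by
      have : (0 : ℝ) < M := by exact_mod_cast (by omega : 0 < M)
      have : (0 : ℝ) < r := by exact_mod_cast (by omega : 0 < r)
      positivity
    have h3 : 0 < (userCluster π a).card := by exact_mod_cast h2.trans_le h1
    obtain ⟨u, hu⟩ := Finset.card_pos.1 h3
    exact ⟨⟨u, hu⟩⟩
  have hmem : ∀ {a u}, u ∈ userCluster π a → π u 0 = a := fun h => (Finset.mem_filter.1 h).2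
  refine ⟨hnonneg, fun u x => ?_, hne, hgap, ?_, hbest, hcard, hdecomp, fun a ha => ?_⟩
  · have e1 := abs_le.1 (hR1 u x)
    have e2 := abs_le.1 (hR1 u (π u 0))
    simp only [itemGap]
    linarith [e1.1, e2.2]
  · have : Nonempty {a : Fin N // a ∈ A} := (Finset.card_pos.1 (by omega : 0 < A.card)).to_subtype
    obtain ⟨a, ha⟩ := exists_eq_ciInf_of_finite
      (f := fun a : {a : Fin N // a ∈ A} =>
        ⨆ u : {u : Fin M // u ∈ userCluster π a}, hottGapOfUser R π A u)
    obtain ⟨u⟩ := hclne a a.2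
    have h1 : hottGapOfUser R π A u ≤
        ⨆ u : {u : Fin M // u ∈ userCluster π a}, hottGapOfUser R π A u :=
      le_ciSup (f := fun u : {u : Fin M // u ∈ userCluster π a} => hottGapOfUser R π A u)
        (Set.finite_range _).bddAbove u
    obtain ⟨b, hb, hba⟩ : ∃ b ∈ A, b ≠ π u 0 :=
      Finset.exists_mem_ne (lt_of_lt_of_le one_lt_two hcard) _
    have : Nonempty {v : Fin N // v ∈ A.erase (π u 0)} := ⟨⟨b, Finset.mem_erase.2 ⟨hba, hb⟩⟩⟩
    obtain ⟨v, hv⟩ := exists_eq_ciSup_of_finite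
      (f := fun v : {v : Fin N // v ∈ A.erase (π u 0)} => R u v)
    have h2 := hne u v (Finset.ne_of_mem_erase v.2)
    unfold hottGap
    rw [← ha]
    refine lt_of_lt_of_le ?_ h1
    unfold hottGapOfUser
    rw [← hv]
    exact hgap.trans_le h2
  · have h1 : hottGap R π A ≤ ⨆ u : {u : Fin M // u ∈ userCluster π a}, hottGapOfUser R π A u :=
      ciInf_le (f := fun a : {a : Fin N // a ∈ A} =>
        ⨆ u : {u : Fin M // u ∈ userCluster π a}, hottGapOfUser R π A u)
        (Set.finite_range _).bddBelow ⟨a, ha⟩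
    have := hclne a ha
    obtain ⟨u, hu⟩ := exists_eq_ciSup_of_finite
      (f := fun u : {u : Fin M // u ∈ userCluster π a} => hottGapOfUser R π A u)
    rw [← hu] at h1
    refine ⟨u, hmem u.2, fun b hb hba => h1.trans ?_⟩
    have h2 : R u b ≤ ⨆ v : {v : Fin N // v ∈ A.erase (π u 0)}, R u v :=
      le_ciSup (f := fun v : {v : Fin N // v ∈ A.erase (π u 0)} => R u v)
        (Set.finite_range _).bddAbove ⟨b, Finset.mem_erase.2 ⟨by rwa [hmem u.2], hb⟩⟩
    unfold hottGapOfUser itemGap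
    linarith

end Instance

/-! ### The regret bound -/

section Bound

open Measure

variable {M N r : ℕ} {R : Matrix (Fin M) (Fin N) ℝ} {Seed : Type*} [MeasurableSpace Seed]
  {O : MCOracle M N Seed} {ν : Measure ℝ} [IsProbabilityMeasure ν]

/-- The number of rounds of the calls made by the algorithm, which involve a whole cluster. -/
theorem rounds_le_of_cluster (hr : 2 ≤ r) {κ : ℝ} (hκ : 0 < κ) (hM : 0 < M)
    {B B' δ : ℝ} (hB : B ≤ B') (hB' : 0 ≤ B') (hO : O.Guarantee R ν B δ) {η : ℝ}
    {rows : Finset (Fin M)}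
    {cols : Finset (Fin N)} (h1 : 0 < η) (h2 : η ≤ 1) (hrows : κ * M / r ≤ (rows.card : ℝ))
    (hcols : cols.Nonempty) :
    (O.rounds η rows cols : ℝ) ≤ B' * max 1 ((r : ℝ) / κ) * max 1 ((N : ℝ) / M) / η ^ 2 := by
  have hM' : (0 : ℝ) < M := by exact_mod_cast hM
  have hr' : (0 : ℝ) < r := by exact_mod_cast (by omega : 0 < r)
  have hlow : 0 < κ * M / r := by positivity
  have hrow0 : (0 : ℝ) < rows.card := hlow.trans_le hrows
  have hne : rows.Nonempty := Finset.card_pos.1 (by exact_mod_cast hrow0)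
  have hN : (cols.card : ℝ) ≤ N := by
    have := cols.card_le_univ
    rw [Fintype.card_fin] at this
    exact_mod_cast this
  refine (hO.rounds_le η rows cols h1 h2 hne hcols).trans ?_
  gcongr ?_ / _
  have hm : max 1 ((cols.card : ℝ) / rows.card) ≤ max 1 ((r : ℝ) / κ) * max 1 ((N : ℝ) / M) := by
    refine max_le ?_ ?_
    · exact one_le_mul_of_one_le_of_one_le (le_max_left _ _) (le_max_left _ _)
    · calc (cols.card : ℝ) / rows.card ≤ N / (κ * M / r) :=
            div_le_div₀ (Nat.cast_nonneg _) hN hlow hrows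
        _ = r / κ * (N / M) := by field_simp
        _ ≤ _ := mul_le_mul (le_max_right _ _) (le_max_right _ _) (by positivity)
            (le_trans zero_le_one (le_max_left _ _))
  calc B * max 1 ((cols.card : ℝ) / rows.card) ≤ B' * max 1 ((cols.card : ℝ) / rows.card) :=
        mul_le_mul_of_nonneg_right hB (le_trans zero_le_one (le_max_left _ _))
    _ ≤ B' * (max 1 ((r : ℝ) / κ) * max 1 ((N : ℝ) / M)) := mul_le_mul_of_nonneg_left hm hB'
    _ = _ := by ring

variable [NeZero N] {A : Finset (Fin N)} {Δ H W : ℝ} {π : Fin M → Equiv.Perm (Fin N)}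

/-- With high probability all calls in the first `T` rounds are accurate: they are at most `T`,
as every call takes a round. Otherwise the regret is at most `2 T`. -/
theorem regret_bounds (h : HottInstance R (fun u => π u 0) A Δ H) (hA : A.card = r) (hW : 0 ≤ W)
    (hrounds : ∀ (η : ℝ) (rows : Finset (Fin M)) (cols : Finset (Fin N)), 0 < η → η ≤ 1 →
      (∃ a ∈ A, ∀ u, π u 0 = a → u ∈ rows) → cols.Nonempty →
      (O.rounds η rows cols : ℝ) ≤ W / η ^ 2) {T : ℕ} (hT : 1 ≤ T) {B δ : ℝ} (hδ : 0 < δ)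
    (hO : O.Guarantee R ν B (δ / T)) :
    runLaw O ν {ω | 120000 * W / H ^ 2 + 2352 * r * W / Δ < regret r O R π T ω} ≤
        ENNReal.ofReal δ ∧
      Integrable (regret r O R π T) (runLaw O ν) ∧
      ∫ ω, regret r O R π T ω ∂runLaw O ν ≤
        120000 * W / H ^ 2 + 2352 * r * W / Δ + 2 * T * δ := by
  set b := 120000 * W / H ^ 2 + 2352 * r * W / Δ with hb
  have hb0 : 0 ≤ b := by
    have := h.gap_pos
    positivity
  have hT0 : (0 : ℝ) < T := by exact_mod_cast hT
  let bad : ℕ → Set (RunSpace M N Seed) := fun n =>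
    {ω | ¬ AccurateCall O R (ω.1 n) ω.2.1 (elimRun r O R ω n).start
      (elimRun r O R ω n).acc (elimRun r O R ω n).block}
  let E : Set (RunSpace M N Seed) := ⋃ n ∈ Finset.range T, bad n
  have hEm : MeasurableSet E := Finset.measurableSet_biUnion _ fun n _ =>
    (measurableSet_accurateCall_elimRun measurable_id n).compl
  have hE : runLaw O ν E ≤ ENNReal.ofReal δ := by
    calc runLaw O ν E ≤ ∑ n ∈ Finset.range T, runLaw O ν (bad n) :=
          measure_biUnion_finset_le _ _
      _ ≤ ∑ n ∈ Finset.range T, ENNReal.ofReal (δ / T) :=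
          Finset.sum_le_sum fun n _ => runLaw_not_accurateCall_le hO n
      _ = ENNReal.ofReal δ := by
          rw [Finset.sum_const, Finset.card_range, nsmul_eq_mul, ← ENNReal.ofReal_natCast,
            ← ENNReal.ofReal_mul hT0.le]
          congr 1
          field_simp
  have hgood : ∀ᵐ ω ∂runLaw O ν, ω ∉ E → regret r O R π T ω ≤ b := by
    filter_upwards [ae_pick_mem (O := O) (ν := ν)] with ω hω hωE
    refine regret_le_of_accurate h hA hW hω hrounds fun n hn => ?_
    by_contra hne
    exact hωE (Set.mem_biUnion (Finset.mem_coe.2 (Finset.mem_range.2 hn)) hne)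
  have hreg0 : ∀ ω, 0 ≤ regret r O R π T ω := fun ω => by
    rw [regret_eq_sum_roundRegret]
    exact Finset.sum_nonneg fun t _ => roundRegret_nonneg h t
  have hreg2 : ∀ ω, regret r O R π T ω ≤ 2 * T := fun ω => by
    rw [regret_eq_sum_roundRegret]
    refine (Finset.sum_le_sum fun t _ => roundRegret_le (w := 2) h fun u => h.le_two u _).trans ?_
    simp [mul_comm]
  have hint : Integrable (regret r O R π T) (runLaw O ν) :=
    Integrable.of_bound (measurable_regret π T).aestronglyMeasurable (2 * T)
      (Filter.Eventually.of_forall fun ω => by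
        rw [Real.norm_of_nonneg (hreg0 ω)]
        exact hreg2 ω)
  refine ⟨(measure_mono_ae ?_).trans hE, hint, ?_⟩
  · filter_upwards [hgood] with ω hω hlt
    by_contra hne
    exact absurd (hω hne) (not_le.2 hlt)
  · calc ∫ ω, regret r O R π T ω ∂runLaw O ν
        ≤ ∫ ω, (b + E.indicator (fun _ => (2 * T : ℝ)) ω) ∂runLaw O ν := by
          refine integral_mono_ae hint ((integrable_const b).add
            ((integrable_const _).indicator hEm)) ?_
          filter_upwards [hgood] with ω hω
          by_cases hωE : ω ∈ E
          · simp only [Set.indicator_of_mem hωE]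
            linarith [hreg2 ω]
          · simp only [Set.indicator_of_notMem hωE]
            linarith [hω hωE]
      _ = b + (runLaw O ν).real E * (2 * T) := by
          rw [integral_add (integrable_const b) ((integrable_const _).indicator hEm),
            integral_indicator_const _ hEm]
          simp
      _ ≤ b + 2 * T * δ := by
          have : (runLaw O ν).real E ≤ δ := by
            rw [Measure.real]
            exact ENNReal.toReal_le_of_le_ofReal hδ.le hE
          nlinarith

end Bound

theorem theorem1 (r : ℕ) (hr : 2 ≤ r) (κ : ℝ) (hκ : 0 < κ) (σ : NNReal) (C₀ : ℝ) (p₀ : ℕ) :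
    ∃ (C : ℝ) (p : ℕ), 0 < C ∧
      ∀ (M N : ℕ) [NeZero N] (T : ℕ) (δ : ℝ)
        (R : Matrix (Fin M) (Fin N) ℝ)
        (U : Matrix (Fin M) (Fin r) ℝ) (V : Matrix (Fin N) (Fin r) ℝ)
        (A : Finset (Fin N)) (π : Fin M → Equiv.Perm (Fin N))
        (ν : Measure ℝ) [IsProbabilityMeasure ν]
        (Seed : Type*) [MeasurableSpace Seed] (O : MCOracle M N Seed),
        1 ≤ T → 0 < δ → δ < 1 →
        (∀ u j, |R u j| ≤ 1) → R = U * V.transpose → R.rank = r →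
        HottItems V A →
        ((∀ j, V j ∈ convexHull ℝ ((fun a => V a) '' (A : Set (Fin N)))) ∨ ∀ u j, 0 ≤ R u j) →
        IsRewardOrdering R π →
        (∀ a ∈ A, κ * M / r ≤ ((userCluster π a).card : ℝ)) →
        0 < rewardGap R π →
        (∫ x, x ∂ν) = 0 → HasSubgaussianMGF id (σ ^ 2) ν →
        O.Guarantee R ν (C₀ * (1 + Real.log (M * N / (δ / T))) ^ p₀) (δ / T) →
        runLaw O ν {ω | C * (1 + Real.log (M * N * T / δ)) ^ p *
            (max 1 ((N : ℝ) / M) * ((hottGap R π A)⁻¹ ^ 2 + (rewardGap R π)⁻¹) + 1)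
              < regret r O R π T ω} ≤ ENNReal.ofReal δ ∧
        (δ ≤ 1 / T →
          Integrable (regret r O R π T) (runLaw O ν) ∧
          ∫ ω, regret r O R π T ω ∂(runLaw O ν) ≤
            C * (1 + Real.log (M * N * T / δ)) ^ p *
              (max 1 ((N : ℝ) / M) * ((hottGap R π A)⁻¹ ^ 2 + (rewardGap R π)⁻¹) + 1)) := by
  set K : ℝ := |C₀| * max 1 ((r : ℝ) / κ) * (120000 + 2352 * r) with hK
  have hK0 : 0 ≤ K := by positivity
  refine ⟨K + 2, p₀, by positivity, ?_⟩
  intro M N _ T δ R U V A π ν _ Seed _ O hT hδ hδ1 hR1 hR hrank hV hconv hπ hcl hgap _ _ hO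
  have h := hottInstance hr hκ hR1 hR hrank hV hconv hπ hcl hgap
  have hM := h.users_pos
  have hΔ := h.gap_pos
  have hH := h.hott_pos
  have hT' : (1 : ℝ) ≤ T := by exact_mod_cast hT
  have hM' : (1 : ℝ) ≤ M := by exact_mod_cast hM
  have hN' : (1 : ℝ) ≤ N := by exact_mod_cast Nat.one_le_iff_ne_zero.2 (NeZero.ne N)
  set L : ℝ := 1 + Real.log (M * N * T / δ) with hL
  have hlog : (M : ℝ) * N / (δ / T) = M * N * T / δ := by field_simp
  rw [hlog, ← hL] at hO
  have hL1 : 1 ≤ L := by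
    have h1 : 1 ≤ (M : ℝ) * N * T / δ := by
      rw [le_div_iff₀ hδ, one_mul]
      have := one_le_mul_of_one_le_of_one_le (one_le_mul_of_one_le_of_one_le hM' hN') hT'
      linarith
    have := Real.log_nonneg h1
    rw [hL]
    linarith
  have hLp : 1 ≤ L ^ p₀ := one_le_pow₀ hL1
  set X : ℝ := max 1 ((N : ℝ) / M) with hX
  have hX1 : 1 ≤ X := le_max_left _ _
  set Y : ℝ := X * ((hottGap R π A)⁻¹ ^ 2 + (rewardGap R π)⁻¹) with hY
  have hY0 : 0 ≤ Y := by positivity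
  set W : ℝ := |C₀| * L ^ p₀ * max 1 ((r : ℝ) / κ) * X with hWdef
  have hW : 0 ≤ W := by positivity
  have hrounds : ∀ (η : ℝ) (rows : Finset (Fin M)) (cols : Finset (Fin N)), 0 < η → η ≤ 1 →
      (∃ a ∈ A, ∀ u, π u 0 = a → u ∈ rows) → cols.Nonempty →
      (O.rounds η rows cols : ℝ) ≤ W / η ^ 2 := by
    rintro η rows cols h1 h2 ⟨a, ha, hsub⟩ hcols
    refine rounds_le_of_cluster hr hκ hM (B' := |C₀| * L ^ p₀)
      (mul_le_mul_of_nonneg_right (le_abs_self C₀) (by positivity)) (by positivity) hO h1 h2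
      ((hcl a ha).trans ?_) hcols
    exact_mod_cast Finset.card_le_card fun u hu => hsub u (Finset.mem_filter.1 hu).2
  obtain ⟨hprob, hint, hexp⟩ := regret_bounds h hV.1 hW hrounds hT hδ hO
  have hbound : 120000 * W / hottGap R π A ^ 2 + 2352 * r * W / rewardGap R π + 2 ≤
      (K + 2) * L ^ p₀ * (Y + 1) := by
    have h1 : 120000 * W / hottGap R π A ^ 2 + 2352 * r * W / rewardGap R π ≤ K * L ^ p₀ * Y := by
      have e1 : 120000 * W / hottGap R π A ^ 2 = 120000 * (W * (hottGap R π A)⁻¹ ^ 2) := by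
        rw [div_eq_mul_inv, inv_pow]
        ring
      have e2 : 2352 * r * W / rewardGap R π = 2352 * r * (W * (rewardGap R π)⁻¹) := by
        rw [div_eq_mul_inv]
        ring
      have e3 : K * L ^ p₀ * Y = (120000 + 2352 * r) *
          (W * (hottGap R π A)⁻¹ ^ 2 + W * (rewardGap R π)⁻¹) := by
        rw [hK, hY, hWdef]
        ring
      rw [e1, e2, e3]
      have p1 : 0 ≤ W * (hottGap R π A)⁻¹ ^ 2 := by positivity
      have p2 : 0 ≤ W * (rewardGap R π)⁻¹ := by positivity
      have p3 : 0 ≤ (r : ℝ) * (W * (hottGap R π A)⁻¹ ^ 2) := by positivity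
      nlinarith
    have h2 : 0 ≤ L ^ p₀ * Y := by positivity
    have h3 : 0 ≤ K * L ^ p₀ := by positivity
    nlinarith
  refine ⟨(measure_mono fun ω hω => ?_).trans hprob, fun hδT => ⟨hint, hexp.trans ?_⟩⟩
  · have hω' : (K + 2) * L ^ p₀ * (Y + 1) < regret r O R π T ω := hω
    show 120000 * W / hottGap R π A ^ 2 + 2352 * r * W / rewardGap R π < regret r O R π T ω
    linarith
  · have : T * δ ≤ 1 := by
      rwa [le_div_iff₀ (by linarith), mul_comm] at hδT
    linarith
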